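/- Notation. For $n\ge 1$ and $|z|<1$ let ${\rm Li}_n(z)=\sum_{k>0}z^k/k^n$. Let $\zeta$ be the Riemann zeta function, $\lambda(n)=\sum_{k\ge0}(2k+1)^{-n}$ for $n\ge2$, and $\beta(n)=\sum_{k\ge0}(-1)^k(2k+1)^{-n}$ for $n\ge1$. Put $L_n=(-\log 2)^n/n!$ for $n\ge0$ and $L_n=0$ for $n<0$. For integers $a_1,\dots,a_8$, extended to a sequence $(a_k)_{k\ge1}$ of period 8, put $$S_{n,p}(a_1,\dots,a_8)=\sum_{k>0}\frac{a_k}{2^{\lfloor (pk+p)/2\rfloor}\,k^n}.$$ Define $$A_n={\rm Li}_n(\tfrac12),\qquad B_n=\Re\{2^{n-1}{\rm Li}_n(\tfrac{1+i}{2})\},\qquad F_n=\Im\{2^{n-1}{\rm Li}_n(\tfrac{1+i}{2})\},$$ $$C_n=\Re\{(\tfrac23)^{n-1}{\rm Li}_n(\tfrac{i}{\sqrt8})-2^n{\rm Li}_n(\tfrac{-i}{\sqrt2})\},$$ $$D_n=\Re\{(\tfrac23)^{n-1}{\rm Li}_n(\tfrac{1+i}{4})-{\rm Li}_n(\tfrac{-i}{2})\},\qquad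 G_n=\Im\{(\tfrac23)^{n-1}{\rm Li}_n(\tfrac{1+i}{4})-{\rm Li}_n(\tfrac{-i}{2})\},$$ $$E_n=\Re\{(\tfrac25)^{n-1}{\rm Li}_n(\tfrac{1-i}{8})-2\,{\rm Li}_n(\tfrac{-i}{2})\},\qquad H_n=\Im\{(\tfrac25)^{n-1}{\rm Li}_n(\tfrac{1-i}{8})-2\,{\rm Li}_n(\tfrac{-i}{2})\},$$ and $$\overline A_n=A_n+L_n-\tfrac12\zeta(2)L_{n-2},\quad \overline B_n=B_n+\tfrac12L_n-\tfrac58\zeta(2)L_{n-2},\quad \overline C_n=C_n+\tfrac12L_n-\tfrac13\zeta(2)L_{n-2},$$ $$\overline D_n=D_n+\tfrac12L_n-\tfrac5{24}\zeta(2)L_{n-2},\quad \overline E_n=E_n+\tfrac12L_n-\tfrac7{40}\zeta(2)L_{n-2},$$ $$\overline F_n=F_n-\beta(1)L_{n-1},\quad \overline G_n=G_n-\beta(1)L_{n-1},\quad \overline H_n=H_n-\beta(1)L_{n-1}.$$ Theorem. One has $$\lambda(3)=\overline A_3=\tfrac25\overline B_3=\tfrac97\overline C_3=3\overline D_3=\tfrac{25}{6}\overline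 E_3,$$ $$\beta(3)=\tfrac{1}{32}\pi^3=\tfrac23\overline F_3-\overline G_3=\tfrac{20}{23}\overline F_3-\tfrac{25}{23}\overline H_3,$$ and $$\log^3 2=192\,S_{3,1}(0,1,0,4,0,1,0,16)-32\,S_{3,3}(4,-3,-4,-1,-4,-3,4,7),$$ $$\lambda(3)=\tfrac78\zeta(3)=6\,S_{3,1}(1,-7,-1,10,-1,-7,1,0)+4\,S_{3,3}(1,1,-1,-2,-1,1,1,0),$$ $$\beta(3)=\tfrac1{32}\pi^3=5\,S_{3,1}(1,-6,1,0,-1,6,-1,0)+\tfrac53\,S_{3,3}(1,1,1,0,-1,-1,-1,0)+2\,S_{3,5}(1,1,1,0,-1,-1,-1,0).$$ -/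

import Mathlib

namespace Ladder

noncomputable section

/-- The polylogarithm `Li_n(z) = ∑_{k>0} z^k / k^n` (used for `‖z‖ < 1`). -/
def Li (n : ℕ) (z : ℂ) : ℂ := ∑' k : ℕ, z ^ (k + 1) / ((k : ℂ) + 1) ^ n

/-- `λ(n) = ∑_{k≥0} (2k+1)^{-n}` (for `n ≥ 2`). -/
def lam (n : ℕ) : ℝ := ∑' k : ℕ, 1 / (2 * (k : ℝ) + 1) ^ n

/-- `β(n) = ∑_{k≥0} (-1)^k (2k+1)^{-n}` (for `n ≥ 1`), as the limit of the partial sums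
over `k < N`, since the series is only conditionally convergent for `n = 1`. -/
def beta (n : ℕ) : ℝ :=
  ∑'[SummationFilter.conditional ℕ] k : ℕ, (-1 : ℝ) ^ k / (2 * (k : ℝ) + 1) ^ n

/-- The real number `ζ(2)`. -/
def zetaTwo : ℝ := (riemannZeta 2).re

/-- `L_n = (-log 2)^n / n!`, with `L_n = 0` for `n < 0`. -/
def L (n : ℤ) : ℝ := if n < 0 then 0 else (-Real.log 2) ^ n.toNat / (n.toNat.factorial : ℝ)

/-- `S_{n,p}(a_1, …, a_8) = ∑_{k>0} a_k / (2^⌊(pk+p)/2⌋ k^n)`, where `a_k` has period 8.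
The summation variable is `j = k - 1`, and `a i` stands for `a_{i+1}`. -/
def S (n p : ℕ) (a : Fin 8 → ℤ) : ℝ :=
  ∑' j : ℕ, (a ⟨j % 8, Nat.mod_lt j (by norm_num)⟩ : ℝ) /
    (2 ^ ((p * (j + 1) + p) / 2) * ((j : ℝ) + 1) ^ n)

def A (n : ℕ) : ℝ := (Li n (1 / 2)).re

def B (n : ℕ) : ℝ := ((2 : ℂ) ^ ((n : ℤ) - 1) * Li n ((1 + Complex.I) / 2)).re

def C (n : ℕ) : ℝ :=
  ((2 / 3 : ℂ) ^ ((n : ℤ) - 1) * Li n (Complex.I / (√8 : ℝ))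
    - (2 : ℂ) ^ n * Li n (-Complex.I / (√2 : ℝ))).re

def D (n : ℕ) : ℝ :=
  ((2 / 3 : ℂ) ^ ((n : ℤ) - 1) * Li n ((1 + Complex.I) / 4) - Li n (-Complex.I / 2)).re

def E (n : ℕ) : ℝ :=
  ((2 / 5 : ℂ) ^ ((n : ℤ) - 1) * Li n ((1 - Complex.I) / 8) - 2 * Li n (-Complex.I / 2)).re

def F (n : ℕ) : ℝ := ((2 : ℂ) ^ ((n : ℤ) - 1) * Li n ((1 + Complex.I) / 2)).im

def G (n : ℕ) : ℝ :=
  ((2 / 3 : ℂ) ^ ((n : ℤ) - 1) * Li n ((1 + Complex.I) / 4) - Li n (-Complex.I / 2)).im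

def H (n : ℕ) : ℝ :=
  ((2 / 5 : ℂ) ^ ((n : ℤ) - 1) * Li n ((1 - Complex.I) / 8) - 2 * Li n (-Complex.I / 2)).im

def Abar (n : ℕ) : ℝ := A n + L n - 1 / 2 * zetaTwo * L ((n : ℤ) - 2)

def Bbar (n : ℕ) : ℝ := B n + 1 / 2 * L n - 5 / 8 * zetaTwo * L ((n : ℤ) - 2)

def Cbar (n : ℕ) : ℝ := C n + 1 / 2 * L n - 1 / 3 * zetaTwo * L ((n : ℤ) - 2)

def Dbar (n : ℕ) : ℝ := D n + 1 / 2 * L n - 5 / 24 * zetaTwo * L ((n : ℤ) - 2)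

def Ebar (n : ℕ) : ℝ := E n + 1 / 2 * L n - 7 / 40 * zetaTwo * L ((n : ℤ) - 2)

def Fbar (n : ℕ) : ℝ := F n - beta 1 * L ((n : ℤ) - 1)

def Gbar (n : ℕ) : ℝ := G n - beta 1 * L ((n : ℤ) - 1)

def Hbar (n : ℕ) : ℝ := H n - beta 1 * L ((n : ℤ) - 1)

end

end Ladder

/-! Every value in the theorem is a trilogarithm at a point of modulus a power of `2^(-1/2)` and
argument a multiple of `π/4`. The functional equations of `Li 3` relate such points to each other,
to `Li 3 1 = 8/7 * lam 3` and to products of `log 2` and `π`. Duplication (`Li_sq`), inversion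
(`trilog_inversion`) and Landen's equation (`trilog_landen`) give `Li 3` at `-1`, `I` and `1 / 2`,
and its real part at `(1 + I) / 2`. This settles the ladders for `A` and `B` and the value of `beta
3`.

The other ladders need the two-variable Spence–Kummer relation (`trilog_spence_kummer`) at three
pairs `(x, y)`: `(-1, 1/2)` for `C`, `(1 - I, 1/2)` for `D` and `G`, and `(-1, (1 + I)/2)`, combined
with the preceding one, for `E` and `H`. Arguments outside the unit disc are brought back by
inversion.

Each functional equation is proved by differentiating along a segment: the derivative is a
combination of dilogarithm equations, whose derivatives in turn vanish by identities between
logarithms. The multivalued functions are fixed as analytic continuations to the plane cut along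
`[1, ∞)`, and branches of `log` are compared by continuity along the segment.

For the series, powers of the arguments are periodic modulo 8 up to powers of 2, so each
trilogarithm is a combination of the sums of `S` over residue classes. Eliminating unwanted
constants between the evaluated relations leaves the three formulas. -/

namespace Ladder

open Complex Set Filter Topology

noncomputable section

/-! ### Segments, branches of the logarithm and primitives on the cut plane -/

/-- The plane cut along `[1, ∞)`. -/
def cutPlane : Set ℂ := {z | 1 - z ∈ slitPlane}

lemma isOpen_cutPlane : IsOpen cutPlane :=
  isOpen_slitPlane.preimage (by fun_prop)

lemma zero_mem_cutPlane : (0 : ℂ) ∈ cutPlane := by simp [cutPlane]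

lemma mem_cutPlane_of_norm_lt_one {z : ℂ} (hz : ‖z‖ < 1) : z ∈ cutPlane := by
  left
  have := (abs_le.1 (abs_re_le_norm z)).2
  simp only [sub_re, one_re]
  linarith

lemma ne_one_of_mem_cutPlane {z : ℂ} (hz : z ∈ cutPlane) : z ≠ 1 := by
  rintro rfl
  simp [cutPlane] at hz

/-- A function whose derivative vanishes in the interior of a segment and which is continuous
on the segment takes the same value at both ends. -/

lemma eq_of_hasDerivAt_zero_on_openSegment {f : ℂ → ℂ} {p q : ℂ}
    (hc : ContinuousOn f (segment ℝ p q)) (hd : ∀ z ∈ openSegment ℝ p q, HasDerivAt f 0 z) :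
    f q = f p := by
  set g : ℝ → ℂ := fun s => f (p + s * (q - p)) with hg
  have hline : Continuous fun s : ℝ => p + (s : ℂ) * (q - p) := by fun_prop
  have hmap : ∀ s ∈ Icc (0 : ℝ) 1, p + (s : ℂ) * (q - p) ∈ segment ℝ p q := by
    intro s hs
    rw [segment_eq_image']
    exact ⟨s, hs, by simp⟩
  have hmapo : ∀ s ∈ Ioo (0 : ℝ) 1, p + (s : ℂ) * (q - p) ∈ openSegment ℝ p q := by
    intro s hs
    rw [openSegment_eq_image']
    exact ⟨s, hs, by simp⟩
  have hgc : ContinuousOn g (Icc 0 1) := hc.comp hline.continuousOn hmap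
  have hgd : ∀ s ∈ Ioo (0 : ℝ) 1, HasDerivAt g 0 s := by
    intro s hs
    have h1 : HasDerivAt (fun s : ℝ => p + (s : ℂ) * (q - p)) (1 * (q - p)) s :=
      (((hasDerivAt_id s).ofReal_comp).mul_const (q - p)).const_add p
    have h2 := (hd _ (hmapo s hs)).comp s h1
    rw [zero_mul] at h2
    exact h2
  have hconst : ∀ ε ∈ Ioo (0 : ℝ) 1, g ε = g 1 := by
    intro ε hε
    refine (constant_of_has_deriv_right_zero (a := ε) (b := 1)
      (hgc.mono (Icc_subset_Icc_left hε.1.le)) (fun s hs => ?_) 1 ⟨hε.2.le, le_rfl⟩).symm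
    exact (hgd s ⟨hε.1.trans_le hs.1, hs.2⟩).hasDerivWithinAt
  -- No derivative is available at `p`, which in the applications is a singular point such as `0` or
  -- `1`; continuity alone carries the constant value there.
  have hlim : Tendsto g (𝓝[Ioo 0 1] 0) (𝓝 (g 0)) :=
    ((hgc 0 ⟨le_rfl, zero_le_one⟩).mono Ioo_subset_Icc_self).tendsto
  have hlim' : Tendsto g (𝓝[Ioo 0 1] 0) (𝓝 (g 1)) :=
    tendsto_const_nhds.congr' (eventually_nhdsWithin_of_forall fun s hs => (hconst s hs).symm)
  have : (𝓝[Ioo (0 : ℝ) 1] 0).NeBot := by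
    rw [nhdsWithin_Ioo_eq_nhdsGT zero_lt_one]; infer_instance
  have := tendsto_nhds_unique hlim hlim'
  simpa [hg] using this.symm

lemma eq_add_intMul_of_exp_eq {z w : ℂ} (h : exp z = exp w) :
    ∃ n : ℤ, (z - w).im = 2 * Real.pi * n := by
  obtain ⟨n, hn⟩ := exp_eq_exp_iff_exists_int.1 h
  refine ⟨n, ?_⟩
  rw [hn]
  simp
  ring

/-- A continuous logarithm along a segment which starts at the principal logarithm of a function
with values in the slit plane agrees with the principal logarithm. -/

lemma eq_log_of_exp_eq_on_segment {g h : ℂ → ℂ} {p q : ℂ}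
    (hg : ContinuousOn g (segment ℝ p q)) (hh : ContinuousOn h (segment ℝ p q))
    (hs : ∀ z ∈ segment ℝ p q, g z ∈ slitPlane)
    (he : ∀ z ∈ segment ℝ p q, exp (h z) = g z) (h0 : log (g p) = h p) :
    ∀ z ∈ segment ℝ p q, log (g z) = h z := by
  intro z hz
  -- Two logarithms of the same number differ by `2πi` times an integer. That integer is continuous
  -- on a connected set, hence constant, and it is 0 at `p`.
  set d : ℂ → ℝ := fun z => (log (g z) - h z).im / (2 * Real.pi) with hd
  have hdc : ContinuousOn d (segment ℝ p q) :=
    (continuous_im.comp_continuousOn ((hg.clog hs).sub hh)).div_const _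
  have hint : ∀ z ∈ segment ℝ p q, exp (log (g z)) = exp (h z) := fun z hz => by
    rw [exp_log (slitPlane_ne_zero (hs z hz)), he z hz]
  have hmaps : MapsTo d (segment ℝ p q) (range ((↑) : ℤ → ℝ)) := by
    intro z hz
    obtain ⟨n, hn⟩ := eq_add_intMul_of_exp_eq (hint z hz)
    refine ⟨n, ?_⟩
    simp only [hd, hn]
    field_simp
  have hdisc : IsDiscrete (range ((↑) : ℤ → ℝ)) :=
    ⟨Int.isClosedEmbedding_coe_real.isEmbedding.toHomeomorph.symm.isEmbedding.discreteTopology⟩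
  have hdz : d z = d p :=
    (convex_segment p q).isPreconnected.constant_of_mapsTo hdisc hdc hmaps hz (left_mem_segment ℝ p q)
  have hdp : d p = 0 := by simp [hd, h0]
  obtain ⟨n, hn⟩ := exp_eq_exp_iff_exists_int.1 (hint z hz)
  rw [hdp] at hdz
  have him : (log (g z) - h z).im = 0 := by
    have := Real.pi_pos
    simp only [hd] at hdz
    rcases div_eq_zero_iff.1 hdz with h | h
    · exact h
    · linarith
  have hn' : (n : ℝ) * (2 * Real.pi) = 0 := by
    have : (log (g z) - h z).im = n * (2 * Real.pi) := by rw [hn]; simp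
    rw [← this, him]
  have : (n : ℝ) = 0 := by
    rcases mul_eq_zero.1 hn' with h | h
    · exact h
    · have := Real.pi_pos
      linarith
  rw [hn, Int.cast_eq_zero.1 this]
  simp

lemma exp_mem_slitPlane_of_abs_im_lt {w : ℂ} (hw : |w.im| < Real.pi) : exp w ∈ slitPlane := by
  rw [mem_slitPlane_iff_arg, arg_exp]
  refine ⟨?_, exp_ne_zero w⟩
  have h := abs_lt.1 hw
  rw [(toIocMod_eq_self _).2 ⟨h.1, by linarith [h.2]⟩]
  exact h.2.ne

/-- The cut plane is not convex, but `w ↦ 1 - exp w` maps the convex strip `|im w| < π` onto it,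
with inverse `z ↦ log (1 - z)`. A primitive of the pulled-back form on the strip is transported
back. -/
lemma exists_primitive_on_cutPlane {f : ℂ → ℂ} (hf : DifferentiableOn ℂ f cutPlane) :
    ∃ F : ℂ → ℂ, F 0 = 0 ∧ ∀ z ∈ cutPlane, HasDerivAt F (f z) z := by
  set s : Set ℂ := im ⁻¹' (Ioo (-Real.pi) Real.pi)
  have hs : Convex ℝ s := (convex_Ioo (-Real.pi) Real.pi).linear_preimage imLm
  have hso : IsOpen s := isOpen_Ioo.preimage continuous_im
  have hmem : ∀ w ∈ s, 1 - exp w ∈ cutPlane := fun w hw => by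
    simpa [cutPlane] using exp_mem_slitPlane_of_abs_im_lt (abs_lt.2 hw)
  obtain ⟨G, hG⟩ := hs.exists_forall_hasDerivWithinAt
    (f := fun w => f (1 - exp w) * (-exp w))
    ((hf.comp (by fun_prop) hmem).mul (by fun_prop))
  refine ⟨fun z => G (log (1 - z)) - G 0, by simp, fun z hz => ?_⟩
  have hz' : (1 - z) ∈ slitPlane := hz
  have hls : log (1 - z) ∈ s := by
    refine ⟨neg_pi_lt_log_im _, lt_of_le_of_ne (log_im_le_pi _) ?_⟩
    rw [log_im]
    exact (mem_slitPlane_iff_arg.1 hz').1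
  have h1 := (hG _ hls).hasDerivAt (hso.mem_nhds hls)
  have h2 : HasDerivAt (fun z => log (1 - z)) (-1 / (1 - z)) z :=
    ((hasDerivAt_id z).const_sub 1).clog hz'
  have h3 := (h1.comp z h2).sub_const (G 0)
  rw [exp_log (slitPlane_ne_zero hz')] at h3
  have h0 := slitPlane_ne_zero hz'
  refine h3.congr_deriv ?_
  rw [sub_sub_cancel]
  field_simp

/-- Since `f 0 = 0`, the singularity of `f z / z` at 0 is removable and `dslope f 0` is its
holomorphic extension. -/
lemma exists_logPrimitive_on_cutPlane {f : ℂ → ℂ} (hf : DifferentiableOn ℂ f cutPlane)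
    (hf0 : f 0 = 0) :
    ∃ F : ℂ → ℂ, F 0 = 0 ∧ DifferentiableOn ℂ F cutPlane ∧
      ∀ z ∈ cutPlane, z ≠ 0 → HasDerivAt F (f z / z) z := by
  have h : DifferentiableOn ℂ (dslope f 0) cutPlane :=
    (differentiableOn_dslope (isOpen_cutPlane.mem_nhds zero_mem_cutPlane)).2 hf
  obtain ⟨F, hF0, hF⟩ := exists_primitive_on_cutPlane h
  refine ⟨F, hF0, fun z hz => (hF z hz).differentiableAt.differentiableWithinAt,
    fun z hz hz0 => ?_⟩
  have := hF z hz
  rwa [dslope_of_ne _ hz0, slope_def_field, hf0, sub_zero, sub_zero] at this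

/-! ### Dilogarithm and trilogarithm on the cut plane -/

lemma exists_dilog : ∃ F : ℂ → ℂ, F 0 = 0 ∧ DifferentiableOn ℂ F cutPlane ∧
    ∀ z ∈ cutPlane, z ≠ 0 → HasDerivAt F (-log (1 - z) / z) z :=
  exists_logPrimitive_on_cutPlane (f := fun z => -log (1 - z))
    (DifferentiableOn.neg (DifferentiableOn.clog (f := fun z => 1 - z) (by fun_prop)
      (fun _ hz => hz))) (by simp)

/-- The analytic continuation of `Li 2` to the cut plane. -/
def dilog : ℂ → ℂ := exists_dilog.choose

lemma dilog_zero : dilog 0 = 0 := exists_dilog.choose_spec.1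

lemma differentiableOn_dilog : DifferentiableOn ℂ dilog cutPlane := exists_dilog.choose_spec.2.1

lemma hasDerivAt_dilog {z : ℂ} (hz : z ∈ cutPlane) (hz0 : z ≠ 0) :
    HasDerivAt dilog (-log (1 - z) / z) z := exists_dilog.choose_spec.2.2 z hz hz0

lemma exists_trilog : ∃ F : ℂ → ℂ, F 0 = 0 ∧ DifferentiableOn ℂ F cutPlane ∧
    ∀ z ∈ cutPlane, z ≠ 0 → HasDerivAt F (dilog z / z) z :=
  exists_logPrimitive_on_cutPlane differentiableOn_dilog dilog_zero

/-- The analytic continuation of `Li 3` to the cut plane. -/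
def trilog : ℂ → ℂ := exists_trilog.choose

lemma trilog_zero : trilog 0 = 0 := exists_trilog.choose_spec.1

lemma differentiableOn_trilog : DifferentiableOn ℂ trilog cutPlane :=
  exists_trilog.choose_spec.2.1

lemma hasDerivAt_trilog {z : ℂ} (hz : z ∈ cutPlane) (hz0 : z ≠ 0) :
    HasDerivAt trilog (dilog z / z) z := exists_trilog.choose_spec.2.2 z hz hz0

/-! ### The power series on the closed unit disc -/

lemma summable_one_div_succ_pow {n : ℕ} (hn : 2 ≤ n) :
    Summable fun k : ℕ => 1 / ((k : ℝ) + 1) ^ n := by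
  have := (summable_nat_add_iff 1).2 (Real.summable_one_div_nat_pow.2 (show 1 < n by omega))
  simpa using this

lemma norm_Li_term_le_of_norm_le_one (n : ℕ) {z : ℂ} (hz : ‖z‖ ≤ 1) (k : ℕ) :
    ‖z ^ (k + 1) / ((k : ℂ) + 1) ^ n‖ ≤ 1 / ((k : ℝ) + 1) ^ n := by
  have h : ‖((k : ℂ) + 1)‖ = (k : ℝ) + 1 := by
    rw [← Nat.cast_add_one, Complex.norm_natCast]; push_cast; rfl
  rw [norm_div, norm_pow, norm_pow, h]
  gcongr
  exact pow_le_one₀ (norm_nonneg z) hz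

lemma summable_Li {n : ℕ} (hn : 2 ≤ n) {z : ℂ} (hz : ‖z‖ ≤ 1) :
    Summable fun k : ℕ => z ^ (k + 1) / ((k : ℂ) + 1) ^ n :=
  Summable.of_norm_bounded (summable_one_div_succ_pow hn) (norm_Li_term_le_of_norm_le_one n hz)

lemma continuousOn_Li {n : ℕ} (hn : 2 ≤ n) : ContinuousOn (Li n) {z | ‖z‖ ≤ 1} :=
  continuousOn_tsum (fun k => by fun_prop) (summable_one_div_succ_pow hn)
    (fun k _ hz => norm_Li_term_le_of_norm_le_one n hz k)

lemma Li_zero (n : ℕ) : Li n 0 = 0 := by simp [Li]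

lemma Li_one_eq_neg_log {z : ℂ} (hz : ‖z‖ < 1) : Li 1 z = -log (1 - z) := by
  have h := hasSum_taylorSeries_neg_log hz
  rw [← hasSum_nat_add_iff' 1] at h
  simpa [Li] using h.tsum_eq

lemma hasDerivAt_Li (n : ℕ) {z : ℂ} (hz : ‖z‖ < 1) (hz0 : z ≠ 0) :
    HasDerivAt (Li (n + 1)) (Li n z / z) z := by
  obtain ⟨r, hzr, hr1⟩ := exists_between hz
  have hr0 : 0 ≤ r := (norm_nonneg z).trans hzr.le
  have hder : ∀ (k : ℕ) (y : ℂ), y ∈ Metric.ball (0 : ℂ) r →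
      HasDerivAt (fun w : ℂ => w ^ (k + 1) / ((k : ℂ) + 1) ^ (n + 1))
        (y ^ k / ((k : ℂ) + 1) ^ n) y := by
    intro k y _
    have hk : (k : ℂ) + 1 ≠ 0 := Nat.cast_add_one_ne_zero k
    refine ((hasDerivAt_pow (k + 1) y).div_const _).congr_deriv ?_
    push_cast
    rw [pow_succ ((k : ℂ) + 1) n]
    field_simp
  have hbound : ∀ (k : ℕ) (y : ℂ), y ∈ Metric.ball (0 : ℂ) r →
      ‖y ^ k / ((k : ℂ) + 1) ^ n‖ ≤ r ^ k := by
    intro k y hy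
    have hy' : ‖y‖ < r := by simpa using hy
    have h : ‖((k : ℂ) + 1)‖ = (k : ℝ) + 1 := by
      rw [← Nat.cast_add_one, Complex.norm_natCast]; push_cast; rfl
    rw [norm_div, norm_pow, norm_pow, h]
    refine (div_le_self (by positivity)
      (one_le_pow₀ (by linarith [(Nat.cast_nonneg k : (0 : ℝ) ≤ k)]))).trans ?_
    gcongr
  have h := hasDerivAt_tsum_of_isPreconnected (summable_geometric_of_lt_one hr0 hr1)
    Metric.isOpen_ball (convex_ball (0 : ℂ) r).isPreconnected hder hbound
    (Metric.mem_ball_self ((norm_nonneg z).trans_lt hzr)) (by simp)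
    (show z ∈ Metric.ball (0 : ℂ) r by simpa using hzr)
  refine h.congr_deriv ?_
  rw [Li, ← tsum_div_const]
  refine tsum_congr fun k => ?_
  rw [pow_succ]
  field_simp

lemma norm_lt_one_of_mem_openSegment_zero {z w : ℂ} (hz : ‖z‖ ≤ 1)
    (hw : w ∈ openSegment ℝ 0 z) : ‖w‖ < 1 := by
  rw [openSegment_eq_image'] at hw
  obtain ⟨t, ht, rfl⟩ := hw
  simp only [sub_zero, zero_add, norm_smul, Real.norm_eq_abs, abs_of_pos ht.1]
  nlinarith [ht.1, ht.2, norm_nonneg z]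

lemma ne_zero_of_mem_openSegment_zero {z w : ℂ} (hz : z ≠ 0)
    (hw : w ∈ openSegment ℝ 0 z) : w ≠ 0 := by
  rw [openSegment_eq_image'] at hw
  obtain ⟨t, ht, rfl⟩ := hw
  simp [hz, ht.1.ne']

lemma norm_le_one_of_mem_segment {p q w : ℂ} (hp : ‖p‖ ≤ 1) (hq : ‖q‖ ≤ 1)
    (hw : w ∈ segment ℝ p q) : ‖w‖ ≤ 1 := by
  have := (convex_closedBall (0 : ℂ) 1).segment_subset (x := p) (y := q)
    (by simpa using hp) (by simpa using hq) hw
  simpa using this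

lemma mem_cutPlane_of_norm_le_one {z : ℂ} (hz : ‖z‖ ≤ 1) (hz1 : z ≠ 1) : z ∈ cutPlane := by
  by_cases h : z.im = 0
  · left
    have h1 := (abs_le.1 ((abs_re_le_norm z).trans hz)).2
    have h2 : z.re ≠ 1 := fun h2 => hz1 (Complex.ext h2 h)
    have h3 := lt_of_le_of_ne h1 h2
    simp only [sub_re, one_re]
    linarith
  · right
    simpa using h

lemma mem_cutPlane_of_mem_segment_zero {z w : ℂ} (hz : z ∈ cutPlane)
    (hw : w ∈ segment ℝ 0 z) : w ∈ cutPlane := by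
  rw [segment_eq_image'] at hw
  obtain ⟨t, ht, rfl⟩ := hw
  rcases ht.1.eq_or_lt with h0 | h0
  · simp [← h0, zero_mem_cutPlane]
  rcases hz with hz | hz
  · left
    simp at hz ⊢
    nlinarith [ht.2]
  · right
    simp at hz ⊢
    exact ⟨h0.ne', hz⟩

/-- Both functions vanish at 0 and have the same derivative along the radius to `z`; continuity up
to the closed disc covers `‖z‖ = 1`. The point 1 is excluded because it lies on the cut. -/
lemma eq_Li_succ_of_hasDerivAt {n : ℕ} (hn : 1 ≤ n) {F : ℂ → ℂ} (hF0 : F 0 = 0)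
    (hFc : DifferentiableOn ℂ F cutPlane)
    (hF : ∀ z, ‖z‖ < 1 → z ≠ 0 → HasDerivAt F (Li n z / z) z)
    {z : ℂ} (hz : ‖z‖ ≤ 1) (hz1 : z ≠ 1) : F z = Li (n + 1) z := by
  rcases eq_or_ne z 0 with rfl | hz0
  · rw [hF0, Li_zero]
  have h := eq_of_hasDerivAt_zero_on_openSegment (f := fun w => F w - Li (n + 1) w)
    (p := 0) (q := z) ?_ ?_
  · simp only [hF0, Li_zero, sub_zero] at h
    exact sub_eq_zero.1 h
  · refine ContinuousOn.sub (hFc.continuousOn.mono fun w hw => ?_)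
      ((continuousOn_Li (by omega)).mono fun w hw => ?_)
    · exact mem_cutPlane_of_mem_segment_zero (mem_cutPlane_of_norm_le_one hz hz1) hw
    · exact norm_le_one_of_mem_segment (by simp) hz hw
  · intro w hw
    have hw1 := norm_lt_one_of_mem_openSegment_zero hz hw
    have hw0 := ne_zero_of_mem_openSegment_zero hz0 hw
    exact ((hF w hw1 hw0).sub (hasDerivAt_Li n hw1 hw0)).congr_deriv (sub_self _)

lemma dilog_eq_Li {z : ℂ} (hz : ‖z‖ ≤ 1) (hz1 : z ≠ 1) : dilog z = Li 2 z :=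
  eq_Li_succ_of_hasDerivAt le_rfl dilog_zero differentiableOn_dilog
    (fun w hw hw0 => by
      rw [Li_one_eq_neg_log hw]
      exact hasDerivAt_dilog (mem_cutPlane_of_norm_lt_one hw) hw0) hz hz1

lemma trilog_eq_Li {z : ℂ} (hz : ‖z‖ ≤ 1) (hz1 : z ≠ 1) : trilog z = Li 3 z :=
  eq_Li_succ_of_hasDerivAt (by norm_num) trilog_zero differentiableOn_trilog
    (fun w hw hw0 => by
      rw [← dilog_eq_Li hw.le (ne_one_of_mem_cutPlane (mem_cutPlane_of_norm_lt_one hw))]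
      exact hasDerivAt_trilog (mem_cutPlane_of_norm_lt_one hw) hw0) hz hz1

lemma Li_sq {n : ℕ} (hn : 2 ≤ n) {z : ℂ} (hz : ‖z‖ ≤ 1) :
    2 * Li n (z ^ 2) = 2 ^ n * (Li n z + Li n (-z)) := by
  have hs := summable_Li hn hz
  have hs' := summable_Li hn (z := -z) (by simpa using hz)
  set f : ℕ → ℂ := fun k => z ^ (k + 1) / ((k : ℂ) + 1) ^ n + (-z) ^ (k + 1) / ((k : ℂ) + 1) ^ n
    with hf
  have hadd : Summable f := hs.add hs'
  have hinj2 : Function.Injective fun k : ℕ => 2 * k := fun a b h => by simpa using h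
  have hinj3 : Function.Injective fun k : ℕ => 2 * k + 1 := fun a b h => by simpa using h
  have hsum : Li n z + Li n (-z) = ∑' k, f k := (hs.tsum_add hs').symm
  have hsplit : ∑' k, f (2 * k) + ∑' k, f (2 * k + 1) = ∑' k, f k :=
    tsum_even_add_odd (hadd.comp_injective hinj2) (hadd.comp_injective hinj3)
  -- The index is shifted by one: index `2 * k` carries the odd power `2 * k + 1`, which cancels
  -- between `z` and `-z`.
  have heven : ∀ k : ℕ, f (2 * k) = 0 := by
    intro k
    simp only [hf]
    rw [Odd.neg_pow ⟨k, rfl⟩]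
    ring
  rw [hsum, ← hsplit, tsum_congr heven, tsum_zero, zero_add, Li, ← tsum_mul_left, ← tsum_mul_left]
  refine tsum_congr fun k => ?_
  have hk : (k : ℂ) + 1 ≠ 0 := Nat.cast_add_one_ne_zero k
  have h2 : (((2 * k + 1 : ℕ) : ℂ) + 1) = 2 * (k + 1) := by push_cast; ring
  simp only [hf]
  rw [h2, show 2 * k + 1 + 1 = 2 * (k + 1) by ring, Even.neg_pow ⟨k + 1, by ring⟩, mul_pow,
    ← pow_mul]
  field_simp
  ring

lemma Li_conj (n : ℕ) (z : ℂ) :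
    Li n ((starRingEnd ℂ) z) = (starRingEnd ℂ) (Li n z) := by
  rw [Li, Li, conj_tsum]
  refine tsum_congr fun k => ?_
  simp

lemma Li_at_one {n : ℕ} (hn : 2 ≤ n) : Li n 1 = riemannZeta n := by
  rw [zeta_eq_tsum_one_div_nat_add_one_cpow (by simp; omega), Li]
  refine tsum_congr fun k => ?_
  simp

/-! ### One-variable functional equations: Landen, reflection, inversion -/

/-- Here `l` is the logarithmic derivative of `u`. In this form the derivative of a sum of
polylogarithms is linear in the `l`'s, and only those and the factors `log (1 - u x)` have to be
compared. -/
lemma hasDerivAt_dilog_comp {u : ℂ → ℂ} {x l : ℂ} (hu : HasDerivAt u (u x * l) x)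
    (hm : u x ∈ cutPlane) (h0 : u x ≠ 0) :
    HasDerivAt (fun t => dilog (u t)) (-log (1 - u x) * l) x := by
  refine ((hasDerivAt_dilog hm h0).comp x hu).congr_deriv ?_
  field_simp

lemma hasDerivAt_trilog_comp {u : ℂ → ℂ} {x l : ℂ} (hu : HasDerivAt u (u x * l) x)
    (hm : u x ∈ cutPlane) (h0 : u x ≠ 0) :
    HasDerivAt (fun t => trilog (u t)) (dilog (u x) * l) x := by
  refine ((hasDerivAt_trilog hm h0).comp x hu).congr_deriv ?_
  field_simp

lemma continuousOn_dilog_comp {u : ℂ → ℂ} {s : Set ℂ} (hu : ContinuousOn u s)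
    (hm : ∀ x ∈ s, u x ∈ cutPlane) : ContinuousOn (fun t => dilog (u t)) s :=
  differentiableOn_dilog.continuousOn.comp hu hm

lemma continuousOn_trilog_comp {u : ℂ → ℂ} {s : Set ℂ} (hu : ContinuousOn u s)
    (hm : ∀ x ∈ s, u x ∈ cutPlane) : ContinuousOn (fun t => trilog (u t)) s :=
  differentiableOn_trilog.continuousOn.comp hu hm

lemma segment_one_subset_slitPlane {z : ℂ} (hz : z ∈ slitPlane) :
    segment ℝ 1 z ⊆ slitPlane :=
  starConvex_one_slitPlane.segment_subset hz

lemma ne_one_of_mem_openSegment_one {z w : ℂ} (hz : z ≠ 1) (hw : w ∈ openSegment ℝ 1 z) :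
    w ≠ 1 := by
  rw [openSegment_eq_image'] at hw
  obtain ⟨t, ht, rfl⟩ := hw
  simp [sub_eq_zero, hz, ht.1.ne']

lemma inv_mem_slitPlane {z : ℂ} (hz : z ∈ slitPlane) : z⁻¹ ∈ slitPlane := by
  rw [mem_slitPlane_iff_arg] at hz ⊢
  refine ⟨?_, inv_ne_zero hz.2⟩
  rw [arg_inv, if_neg hz.1]
  intro h
  have := neg_pi_lt_arg z
  linarith

lemma log_inv_of_mem_slitPlane {z : ℂ} (hz : z ∈ slitPlane) : log z⁻¹ = -log z :=
  log_inv z (mem_slitPlane_iff_arg.1 hz).1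

lemma one_add_mem_slitPlane {z : ℂ} (hz : z ∈ slitPlane) : 1 + z ∈ slitPlane := by
  rcases hz with h | h
  · left; simp; linarith
  · right; simpa using h

/-- Along the segment from 1 to `z` the derivative reduces to logarithms, with `log w⁻¹ = -log w` on
the slit plane; all terms vanish at 1. -/
lemma dilog_landen {z : ℂ} (hz : z ∈ slitPlane) :
    dilog (1 - z) + dilog (1 - z⁻¹) = -log z ^ 2 / 2 := by
  rcases eq_or_ne z 1 with rfl | hz1
  · simp [dilog_zero]
  have hseg := segment_one_subset_slitPlane hz
  have h := eq_of_hasDerivAt_zero_on_openSegment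
    (f := fun w => dilog (1 - w) + dilog (1 - w⁻¹) + log w ^ 2 / 2) (p := 1) (q := z) ?_ ?_
  · simp only [sub_self, inv_one, dilog_zero, log_one] at h
    linear_combination h
  · refine ((continuousOn_dilog_comp (by fun_prop) fun w hw => ?_).add
      (continuousOn_dilog_comp ?_ fun w hw => ?_)).add ?_
    · simpa [cutPlane] using hseg hw
    · exact continuousOn_const.sub (continuousOn_id.inv₀ fun w hw => slitPlane_ne_zero (hseg hw))
    · simpa [cutPlane] using inv_mem_slitPlane (hseg hw)
    · exact ((continuousOn_id.clog fun w hw => hseg hw).pow 2).div_const 2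
  · intro w hw
    have hws := hseg (openSegment_subset_segment ℝ _ _ hw)
    have hw0 := slitPlane_ne_zero hws
    have hw1 : 1 - w ≠ 0 := sub_ne_zero.2 (ne_one_of_mem_openSegment_one hz1 hw).symm
    have hw1' : w - 1 ≠ 0 := sub_ne_zero.2 (ne_one_of_mem_openSegment_one hz1 hw)
    have e : 1 - w⁻¹ = (w - 1) / w := by field_simp
    have d1 := hasDerivAt_dilog_comp (u := fun w => 1 - w) (x := w) (l := -1 / (1 - w))
      (((hasDerivAt_id w).const_sub 1).congr_deriv (by field_simp))
      (by simpa [cutPlane] using hws) hw1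
    have d2 := hasDerivAt_dilog_comp (u := fun w => 1 - w⁻¹) (x := w) (l := 1 / (w * (w - 1)))
      (((hasDerivAt_inv hw0).const_sub 1).congr_deriv (by rw [e]; field_simp))
      (by simpa [cutPlane] using inv_mem_slitPlane hws) (by rw [e]; positivity)
    have d3 := (((hasDerivAt_log hws).pow 2).div_const 2)
    refine ((d1.add d2).add d3).congr_deriv ?_
    rw [sub_sub_cancel, sub_sub_cancel, log_inv_of_mem_slitPlane hws]
    have : w - 1 = -(1 - w) := by ring
    rw [this]
    field_simp
    push_cast
    ring

lemma tendsto_mul_log_nhds_zero : Tendsto (fun u : ℂ => u * log u) (𝓝 0) (𝓝 0) := by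
  have hb : ∀ u : ℂ, ‖u * log u‖ ≤ |‖u‖ * Real.log ‖u‖| + ‖u‖ * Real.pi := by
    intro u
    rw [norm_mul, abs_mul, abs_norm, ← mul_add]
    gcongr
    refine (norm_le_abs_re_add_abs_im _).trans ?_
    rw [log_re, log_im]
    gcongr
    exact abs_arg_le_pi u
  have hc : Continuous fun u : ℂ => |‖u‖ * Real.log ‖u‖| + ‖u‖ * Real.pi :=
    (Real.continuous_mul_log.comp continuous_norm).abs.add (by fun_prop)
  exact squeeze_zero_norm hb (by simpa using hc.tendsto 0)

/-- `log (1 - u)` is `O(u)` at 0 and `u * log u` tends to 0. -/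
lemma tendsto_log_one_sub_mul_log : Tendsto (fun u : ℂ => log (1 - u) * log u) (𝓝 0) (𝓝 0) := by
  have hd : HasDerivAt (fun u : ℂ => log (1 - u)) (-1 / (1 - 0)) 0 :=
    ((hasDerivAt_id (0 : ℂ)).const_sub 1).clog (by simp)
  have hO : (fun u : ℂ => log (1 - u)) =O[𝓝 0] fun u : ℂ => u := by
    simpa using hd.isBigO_sub
  exact (hO.mul (Asymptotics.isBigO_refl (fun u : ℂ => log u) _)).trans_tendsto
    tendsto_mul_log_nhds_zero

lemma norm_lt_one_of_mem_openSegment_one {z w : ℂ} (hz : ‖z‖ < 1)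
    (hw : w ∈ openSegment ℝ 1 z) : ‖w‖ < 1 := by
  have := (convex_closedBall (0 : ℂ) 1).openSegment_closure_interior_subset_interior (x := 1)
    (y := z) (subset_closure (by simp)) (by simpa [interior_closedBall] using hz) hw
  simpa [interior_closedBall] using this

lemma continuousOn_log_mul_log_one_sub {z : ℂ} (hz : ‖z‖ < 1) (hzs : z ∈ slitPlane) :
    ContinuousOn (fun w : ℂ => log w * log (1 - w)) (segment ℝ 1 z) := by
  intro w hw
  refine ContinuousAt.continuousWithinAt ?_
  rcases eq_or_ne w 1 with rfl | hw1
  · have hc : Continuous fun w : ℂ => 1 - w := by fun_prop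
    have h1 : Tendsto (fun w : ℂ => 1 - w) (𝓝 1) (𝓝 0) := by
      have := hc.tendsto 1
      rwa [sub_self] at this
    have h2 : Tendsto (fun w : ℂ => log (1 - (1 - w)) * log (1 - w)) (𝓝 1) (𝓝 0) :=
      tendsto_log_one_sub_mul_log.comp h1
    simp only [sub_sub_cancel] at h2
    simpa [ContinuousAt] using h2
  · have hwc : 1 - w ∈ slitPlane := mem_cutPlane_of_norm_le_one
      (norm_le_one_of_mem_segment (p := 1) (by simp) hz.le hw) hw1
    have hl : ContinuousAt (fun w : ℂ => log (1 - w)) w :=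
      ContinuousAt.clog (f := fun w : ℂ => 1 - w) (by fun_prop) hwc
    exact (continuousAt_clog (segment_one_subset_slitPlane hzs hw)).mul hl

lemma Li_two_one : Li 2 1 = (Real.pi : ℂ) ^ 2 / 6 := by
  rw [Li_at_one le_rfl]
  exact_mod_cast riemannZeta_two

/-- The constant is the value at 1, which is on the cut. The series `Li 2` therefore replaces
`dilog` along the segment, being continuous on the closed disc; hence the hypothesis `‖z‖ < 1`. -/
lemma dilog_add_dilog_one_sub {z : ℂ} (hz : ‖z‖ < 1) (hzs : z ∈ slitPlane) :
    dilog z + dilog (1 - z) = (Real.pi : ℂ) ^ 2 / 6 - log z * log (1 - z) := by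
  have hseg := segment_one_subset_slitPlane hzs
  have hz1 : z ≠ 1 := by rintro rfl; simp at hz
  have hcut1 : 1 - z ≠ 0 := sub_ne_zero.2 hz1.symm
  have h := eq_of_hasDerivAt_zero_on_openSegment
    (f := fun w => Li 2 w + dilog (1 - w) + log w * log (1 - w)) (p := 1) (q := z) ?_ ?_
  · simp only [sub_self, dilog_zero, log_one, Li_two_one] at h
    rw [dilog_eq_Li hz.le hz1]
    linear_combination h
  · refine (((continuousOn_Li le_rfl).mono fun w hw => ?_).add
      (continuousOn_dilog_comp (by fun_prop) fun w hw => ?_)).add ?_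
    · exact norm_le_one_of_mem_segment (by simp) hz.le hw
    · simpa [cutPlane] using hseg hw
    · exact continuousOn_log_mul_log_one_sub hz hzs
  · intro w hw
    have hws := hseg (openSegment_subset_segment ℝ _ _ hw)
    have hw0 := slitPlane_ne_zero hws
    have hwn := norm_lt_one_of_mem_openSegment_one hz hw
    have hw1 : 1 - w ≠ 0 := sub_ne_zero.2 (ne_one_of_mem_openSegment_one hz1 hw).symm
    have d1 := hasDerivAt_Li 1 hwn hw0
    rw [Li_one_eq_neg_log hwn] at d1
    have d2 := hasDerivAt_dilog_comp (u := fun w => 1 - w) (x := w) (l := -1 / (1 - w))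
      (((hasDerivAt_id w).const_sub 1).congr_deriv (by field_simp))
      (by simpa [cutPlane] using hws) hw1
    have d3 : HasDerivAt (fun w : ℂ => log (1 - w)) (-1 / (1 - w)) w :=
      ((hasDerivAt_id w).const_sub 1).clog (mem_cutPlane_of_norm_lt_one hwn)
    have d4 := hasDerivAt_log hws
    refine ((d1.add d2).add (d4.mul d3)).congr_deriv ?_
    rw [sub_sub_cancel]
    field_simp
    ring

lemma Li_neg_one {n : ℕ} (hn : 2 ≤ n) : 2 ^ n * Li n (-1) = (2 - 2 ^ n) * Li n 1 := by
  have := Li_sq hn (z := 1) (by simp)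
  rw [one_pow] at this
  linear_combination -this

lemma dilog_neg_one : dilog (-1) = -(Real.pi : ℂ) ^ 2 / 12 := by
  rw [dilog_eq_Li (by simp) (by norm_num)]
  have := Li_neg_one (n := 2) le_rfl
  rw [Li_two_one] at this
  linear_combination this / 4

lemma log_one_add_inv {x : ℂ} (hx : x ∈ slitPlane) :
    log (1 + x⁻¹) = log (1 + x) - log x := by
  have hseg := segment_one_subset_slitPlane hx
  refine eq_log_of_exp_eq_on_segment (g := fun w => 1 + w⁻¹) (h := fun w => log (1 + w) - log w)
    (p := 1) (q := x) ?_ ?_ (fun w hw => one_add_mem_slitPlane (inv_mem_slitPlane (hseg hw)))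
    (fun w hw => ?_) (by simp) x (right_mem_segment ℝ 1 x)
  · exact continuousOn_const.add (continuousOn_id.inv₀ fun w hw => slitPlane_ne_zero (hseg hw))
  · exact (ContinuousOn.clog (by fun_prop) fun w hw => one_add_mem_slitPlane (hseg hw)).sub
      (continuousOn_id.clog fun w hw => hseg hw)
  · have h0 := slitPlane_ne_zero (hseg hw)
    rw [exp_sub, exp_log (slitPlane_ne_zero (one_add_mem_slitPlane (hseg hw))), exp_log h0]
    field_simp
    ring

lemma neg_mem_cutPlane {x : ℂ} (hx : x ∈ slitPlane) : -x ∈ cutPlane := by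
  simpa [cutPlane] using one_add_mem_slitPlane hx

lemma hasDerivAt_neg_inv {x : ℂ} (hx : x ≠ 0) :
    HasDerivAt (fun w : ℂ => -w⁻¹) (-x⁻¹ * (-x⁻¹)) x :=
  (hasDerivAt_inv hx).neg.congr_deriv (by field_simp)

lemma hasDerivAt_neg_logDeriv {x : ℂ} (hx : x ≠ 0) :
    HasDerivAt (fun w : ℂ => -w) (-x * x⁻¹) x :=
  (hasDerivAt_id x).neg.congr_deriv (by field_simp)

lemma continuousOn_neg_inv {s : Set ℂ} (hs : s ⊆ slitPlane) :
    ContinuousOn (fun w : ℂ => -w⁻¹) s :=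
  (continuousOn_id.inv₀ fun _ hw => slitPlane_ne_zero (hs hw)).neg

/-- The derivative vanishes by `log_one_add_inv`; the constant is twice the value at `-1`. -/
lemma dilog_inversion {x : ℂ} (hx : x ∈ slitPlane) :
    dilog (-x) + dilog (-x⁻¹) = -(Real.pi : ℂ) ^ 2 / 6 - log x ^ 2 / 2 := by
  have hseg := segment_one_subset_slitPlane hx
  have h := eq_of_hasDerivAt_zero_on_openSegment
    (f := fun w => dilog (-w) + dilog (-w⁻¹) + log w ^ 2 / 2) (p := 1) (q := x) ?_ ?_
  · simp only [inv_one, dilog_neg_one, log_one] at h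
    linear_combination h
  · exact ((continuousOn_dilog_comp (by fun_prop) fun w hw => neg_mem_cutPlane (hseg hw)).add
      (continuousOn_dilog_comp (continuousOn_neg_inv hseg)
        fun w hw => neg_mem_cutPlane (inv_mem_slitPlane (hseg hw)))).add
      (((continuousOn_id.clog fun w hw => hseg hw).pow 2).div_const 2)
  · intro w hw
    have hws := hseg (openSegment_subset_segment ℝ _ _ hw)
    have hw0 := slitPlane_ne_zero hws
    have d1 := hasDerivAt_dilog_comp (hasDerivAt_neg_logDeriv hw0) (neg_mem_cutPlane hws)
      (neg_ne_zero.2 hw0)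
    have d2 := hasDerivAt_dilog_comp (hasDerivAt_neg_inv hw0)
      (neg_mem_cutPlane (inv_mem_slitPlane hws)) (neg_ne_zero.2 (inv_ne_zero hw0))
    have d3 := (((hasDerivAt_log hws).pow 2).div_const 2)
    refine ((d1.add d2).add d3).congr_deriv ?_
    rw [sub_neg_eq_add, sub_neg_eq_add, log_one_add_inv hws]
    push_cast
    ring

theorem trilog_inversion {x : ℂ} (hx : x ∈ slitPlane) :
    trilog (-x) = trilog (-x⁻¹) - (Real.pi : ℂ) ^ 2 / 6 * log x - log x ^ 3 / 6 := by
  have hseg := segment_one_subset_slitPlane hx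
  have h := eq_of_hasDerivAt_zero_on_openSegment
    (f := fun w => trilog (-w) - trilog (-w⁻¹) + ((Real.pi : ℂ) ^ 2 / 6 * log w + log w ^ 3 / 6))
    (p := 1) (q := x) ?_ ?_
  · simp only [inv_one, log_one] at h
    linear_combination h
  · have hlog : ContinuousOn (fun w : ℂ => log w) (segment ℝ 1 x) :=
      continuousOn_id.clog fun w hw => hseg hw
    exact ((continuousOn_trilog_comp (by fun_prop) fun w hw => neg_mem_cutPlane (hseg hw)).sub
      (continuousOn_trilog_comp (continuousOn_neg_inv hseg)
        fun w hw => neg_mem_cutPlane (inv_mem_slitPlane (hseg hw)))).add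
      ((continuousOn_const.mul hlog).add ((hlog.pow 3).div_const 6))
  · intro w hw
    have hws := hseg (openSegment_subset_segment ℝ _ _ hw)
    have hw0 := slitPlane_ne_zero hws
    have d1 := hasDerivAt_trilog_comp (hasDerivAt_neg_logDeriv hw0) (neg_mem_cutPlane hws)
      (neg_ne_zero.2 hw0)
    have d2 := hasDerivAt_trilog_comp (hasDerivAt_neg_inv hw0)
      (neg_mem_cutPlane (inv_mem_slitPlane hws)) (neg_ne_zero.2 (inv_ne_zero hw0))
    have d3 := ((hasDerivAt_log hws).const_mul ((Real.pi : ℂ) ^ 2 / 6)).add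
      (((hasDerivAt_log hws).pow 3).div_const 6)
    refine ((d1.sub d2).add d3).congr_deriv ?_
    have := dilog_inversion hws
    push_cast
    -- The derivative is `w⁻¹` times the dilogarithm inversion formula.
    linear_combination w⁻¹ * this

theorem trilog_landen {z : ℂ} (hz : ‖z‖ < 1) (hzs : z ∈ slitPlane) :
    trilog z + trilog (1 - z) + trilog (1 - z⁻¹) = Li 3 1 + log z ^ 3 / 6
      + (Real.pi : ℂ) ^ 2 / 6 * log z - log z ^ 2 * log (1 - z) / 2 := by
  have hseg := segment_one_subset_slitPlane hzs
  have hz1 : z ≠ 1 := by rintro rfl; simp at hz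
  have hlog : ContinuousOn (fun w : ℂ => log w) (segment ℝ 1 z) :=
    continuousOn_id.clog fun w hw => hseg hw
  have h := eq_of_hasDerivAt_zero_on_openSegment
    (f := fun w => Li 3 w + trilog (1 - w) + trilog (1 - w⁻¹) - (log w ^ 3 / 6
      -- The grouping isolates `log w * log (1 - w)`, which is continuous at 1 although `log (1 -
      -- w)` is not.
      + (Real.pi : ℂ) ^ 2 / 6 * log w - log w * (log w * log (1 - w)) / 2))
      (p := 1) (q := z) ?_ ?_
  · simp only [sub_self, inv_one, trilog_zero, log_one] at h
    rw [trilog_eq_Li hz.le hz1]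
    linear_combination h
  · refine ((((continuousOn_Li (by norm_num)).mono fun w hw => ?_).add
      (continuousOn_trilog_comp (by fun_prop) fun w hw => ?_)).add
      (continuousOn_trilog_comp ?_ fun w hw => ?_)).sub
      ((((hlog.pow 3).div_const 6).add (continuousOn_const.mul hlog)).sub
        ((hlog.mul ?_).div_const 2))
    · exact norm_le_one_of_mem_segment (by simp) hz.le hw
    · simpa [cutPlane] using hseg hw
    · exact continuousOn_const.sub (continuousOn_id.inv₀ fun w hw => slitPlane_ne_zero (hseg hw))
    · simpa [cutPlane] using inv_mem_slitPlane (hseg hw)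
    · exact continuousOn_log_mul_log_one_sub hz hzs
  · intro w hw
    have hws := hseg (openSegment_subset_segment ℝ _ _ hw)
    have hw0 := slitPlane_ne_zero hws
    have hwn := norm_lt_one_of_mem_openSegment_one hz hw
    have hne : w ≠ 1 := ne_one_of_mem_openSegment_one hz1 hw
    have hw1 : 1 - w ≠ 0 := sub_ne_zero.2 hne.symm
    have hw1' : w - 1 ≠ 0 := sub_ne_zero.2 hne
    have e : 1 - w⁻¹ = (w - 1) / w := by field_simp
    have d1 := hasDerivAt_Li 2 hwn hw0
    rw [← dilog_eq_Li hwn.le hne] at d1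
    have d2 := hasDerivAt_trilog_comp (u := fun w => 1 - w) (x := w) (l := -1 / (1 - w))
      (((hasDerivAt_id w).const_sub 1).congr_deriv (by field_simp))
      (by simpa [cutPlane] using hws) hw1
    have d3 := hasDerivAt_trilog_comp (u := fun w => 1 - w⁻¹) (x := w)
      (l := -w⁻¹ - 1 / (1 - w))
      (((hasDerivAt_inv hw0).const_sub 1).congr_deriv (by rw [e]; field_simp; ring))
      (by simpa [cutPlane] using inv_mem_slitPlane hws) (by rw [e]; positivity)
    have dl := hasDerivAt_log hws
    have d4 : HasDerivAt (fun w : ℂ => log (1 - w)) (-1 / (1 - w)) w :=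
      ((hasDerivAt_id w).const_sub 1).clog (mem_cutPlane_of_norm_lt_one hwn)
    refine (((d1.add d2).add d3).sub ((((dl.pow 3).div_const 6).add (dl.const_mul _)).sub
      ((dl.mul (dl.mul d4)).div_const 2))).congr_deriv ?_
    have r1 := dilog_landen hws
    have r2 := dilog_add_dilog_one_sub hwn hws
    simp only [Pi.mul_apply]
    push_cast
    linear_combination (-w⁻¹ - 1 / (1 - w)) * r1 + w⁻¹ * r2

/-! ### The Spence–Kummer relation -/

/-- The points `x` for which all arguments of the Spence–Kummer relation with parameter `y`
lie in the cut plane. -/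
structure KummerAdmissible (y x : ℂ) : Prop where
  one_sub : 1 - x ∈ slitPlane
  one_sub_mul : 1 - x * y ∈ slitPlane
  one_sub_div : 1 - x / y ∈ slitPlane
  quot_mul : (1 - x / y) * (1 - x * y) / (1 - x) ^ 2 ∈ slitPlane
  quot_div : (1 - x / y) / (1 - x) ∈ slitPlane
  quot : (1 - x * y) / (1 - x) ∈ slitPlane
  mul_quot_div : y * (1 - x / y) / (1 - x) ∈ slitPlane
  quot_quot : (1 - x * y) / (y * (1 - x)) ∈ slitPlane

section

variable {y x : ℂ}

/-- One minus each argument is a product of powers of `y`, `1 - x`, `1 - x * y` and `1 - x / y`.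
This multiplicative dependence is what makes the dilogarithm derivatives cancel. -/
lemma one_sub_kummer_sq (hy : y ≠ 0) (hx : 1 - x ≠ 0) :
    1 - x * (1 - y) ^ 2 / (y * (1 - x) ^ 2) = (1 - x / y) * (1 - x * y) / (1 - x) ^ 2 := by
  field_simp; ring

lemma one_sub_kummer_div (hy : y ≠ 0) (hx : 1 - x ≠ 0) :
    1 - x * (1 - y) / (y * (1 - x)) = (1 - x / y) / (1 - x) := by
  field_simp; ring

lemma one_sub_kummer_mul (hx : 1 - x ≠ 0) :
    1 - -(x * (1 - y)) / (1 - x) = (1 - x * y) / (1 - x) := by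
  field_simp; ring

lemma one_sub_kummer_quot (hy : y ≠ 0) (hx : 1 - x ≠ 0) :
    1 - (1 - y) / (1 - x) = y * (1 - x / y) / (1 - x) := by
  field_simp; ring

lemma one_sub_kummer_neg_quot (hy : y ≠ 0) (hx : 1 - x ≠ 0) :
    1 - -(1 - y) / (y * (1 - x)) = (1 - x * y) / (y * (1 - x)) := by
  field_simp; ring

lemma hasDerivAt_kummer_sq (hy : y ≠ 0) (hx0 : x ≠ 0) (hx : 1 - x ≠ 0) :
    HasDerivAt (fun t => t * (1 - y) ^ 2 / (y * (1 - t) ^ 2))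
      (x * (1 - y) ^ 2 / (y * (1 - x) ^ 2) * (x⁻¹ + 2 * (1 - x)⁻¹)) x := by
  refine (((hasDerivAt_id x).mul_const _).div
    ((((hasDerivAt_id x).const_sub 1).pow 2).const_mul y)
    (mul_ne_zero hy (pow_ne_zero 2 hx))).congr_deriv ?_
  simp
  field_simp

lemma hasDerivAt_kummer_div (hy : y ≠ 0) (hx0 : x ≠ 0) (hx : 1 - x ≠ 0) :
    HasDerivAt (fun t => t * (1 - y) / (y * (1 - t)))
      (x * (1 - y) / (y * (1 - x)) * (x⁻¹ + (1 - x)⁻¹)) x := by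
  refine (((hasDerivAt_id x).mul_const _).div
    (((hasDerivAt_id x).const_sub 1).const_mul y) (mul_ne_zero hy hx)).congr_deriv ?_
  simp
  field_simp

lemma hasDerivAt_kummer_mul (hx0 : x ≠ 0) (hx : 1 - x ≠ 0) :
    HasDerivAt (fun t => -(t * (1 - y)) / (1 - t))
      (-(x * (1 - y)) / (1 - x) * (x⁻¹ + (1 - x)⁻¹)) x := by
  refine (((hasDerivAt_id x).mul_const _).neg.div
    ((hasDerivAt_id x).const_sub 1) hx).congr_deriv ?_
  simp
  field_simp
  ring

lemma hasDerivAt_kummer_quot (hx : 1 - x ≠ 0) :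
    HasDerivAt (fun t => (1 - y) / (1 - t)) ((1 - y) / (1 - x) * (1 - x)⁻¹) x := by
  refine ((hasDerivAt_const x (1 - y)).div ((hasDerivAt_id x).const_sub 1) hx).congr_deriv ?_
  simp
  field_simp

lemma hasDerivAt_kummer_neg_quot (hy : y ≠ 0) (hx : 1 - x ≠ 0) :
    HasDerivAt (fun t => -(1 - y) / (y * (1 - t)))
      (-(1 - y) / (y * (1 - x)) * (1 - x)⁻¹) x := by
  refine ((hasDerivAt_const x (-(1 - y))).div
    (((hasDerivAt_id x).const_sub 1).const_mul y) (mul_ne_zero hy hx)).congr_deriv ?_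
  simp
  field_simp

lemma hasDerivAt_mul_logDeriv (hx0 : x ≠ 0) :
    HasDerivAt (fun t => t * y) (x * y * x⁻¹) x :=
  ((hasDerivAt_id x).mul_const y).congr_deriv (by field_simp)

lemma hasDerivAt_div_logDeriv (hx0 : x ≠ 0) :
    HasDerivAt (fun t => t / y) (x / y * x⁻¹) x :=
  ((hasDerivAt_id x).div_const y).congr_deriv (by field_simp)

lemma hasDerivAt_id_logDeriv (hx0 : x ≠ 0) : HasDerivAt (fun t : ℂ => t) (x * x⁻¹) x :=
  (hasDerivAt_id x).congr_deriv (by field_simp)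

end

lemma continuousOn_log_kummer {y x₀ : ℂ}
    (hseg : ∀ x ∈ segment ℝ 0 x₀, KummerAdmissible y x) :
    ContinuousOn (fun x => log (1 - x)) (segment ℝ 0 x₀) ∧
    ContinuousOn (fun x => log (1 - x * y)) (segment ℝ 0 x₀) ∧
    ContinuousOn (fun x => log (1 - x / y)) (segment ℝ 0 x₀) :=
  ⟨ContinuousOn.clog (f := fun x => 1 - x) (by fun_prop) fun x hx => (hseg x hx).one_sub,
   ContinuousOn.clog (f := fun x => 1 - x * y) (by fun_prop) fun x hx => (hseg x hx).one_sub_mul,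
   ContinuousOn.clog (f := fun x => 1 - x / y) (by fun_prop) fun x hx => (hseg x hx).one_sub_div⟩

/-- In general such splittings hold only modulo `2πi`. They hold exactly at `x = 0`, and
admissibility along the whole segment keeps the integer from jumping. -/
lemma log_kummer {y x₀ : ℂ} (hy : y ∈ slitPlane)
    (hseg : ∀ x ∈ segment ℝ 0 x₀, KummerAdmissible y x) {x : ℂ} (hx : x ∈ segment ℝ 0 x₀) :
    log ((1 - x / y) * (1 - x * y) / (1 - x) ^ 2)
      = log (1 - x / y) + log (1 - x * y) - 2 * log (1 - x) ∧
    log ((1 - x / y) / (1 - x)) = log (1 - x / y) - log (1 - x) ∧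
    log ((1 - x * y) / (1 - x)) = log (1 - x * y) - log (1 - x) ∧
    log (y * (1 - x / y) / (1 - x)) = log y + log (1 - x / y) - log (1 - x) ∧
    log ((1 - x * y) / (y * (1 - x))) = log (1 - x * y) - log (1 - x) - log y := by
  obtain ⟨ca, cb, cc⟩ := continuousOn_log_kummer hseg
  have hy0 := slitPlane_ne_zero hy
  have ha : ∀ x ∈ segment ℝ 0 x₀, 1 - x ≠ 0 := fun x hx => slitPlane_ne_zero (hseg x hx).one_sub
  have hb : ∀ x ∈ segment ℝ 0 x₀, 1 - x * y ≠ 0 :=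
    fun x hx => slitPlane_ne_zero (hseg x hx).one_sub_mul
  have hc : ∀ x ∈ segment ℝ 0 x₀, 1 - x / y ≠ 0 :=
    fun x hx => slitPlane_ne_zero (hseg x hx).one_sub_div
  have pa : ContinuousOn (fun x : ℂ => 1 - x) (segment ℝ 0 x₀) := by fun_prop
  have pb : ContinuousOn (fun x : ℂ => 1 - x * y) (segment ℝ 0 x₀) := by fun_prop
  have pc : ContinuousOn (fun x : ℂ => 1 - x / y) (segment ℝ 0 x₀) := by fun_prop
  refine ⟨?_, ?_, ?_, ?_, ?_⟩
  · refine eq_log_of_exp_eq_on_segment (g := fun x => (1 - x / y) * (1 - x * y) / (1 - x) ^ 2)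
      (h := fun x => log (1 - x / y) + log (1 - x * y) - 2 * log (1 - x))
      ((pc.mul pb).div (pa.pow 2) fun x hx => pow_ne_zero 2 (ha x hx))
      ((cc.add cb).sub (continuousOn_const.mul ca)) (fun x hx => (hseg x hx).quot_mul)
      (fun x hx => ?_) (by simp) x hx
    rw [exp_sub, exp_add, two_mul, exp_add, exp_log (ha x hx), exp_log (hb x hx),
      exp_log (hc x hx), sq]
  · refine eq_log_of_exp_eq_on_segment (g := fun x => (1 - x / y) / (1 - x))
      (h := fun x => log (1 - x / y) - log (1 - x))
      (pc.div pa ha) (cc.sub ca) (fun x hx => (hseg x hx).quot_div)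
      (fun x hx => ?_) (by simp) x hx
    rw [exp_sub, exp_log (ha x hx), exp_log (hc x hx)]
  · refine eq_log_of_exp_eq_on_segment (g := fun x => (1 - x * y) / (1 - x))
      (h := fun x => log (1 - x * y) - log (1 - x))
      (pb.div pa ha) (cb.sub ca) (fun x hx => (hseg x hx).quot)
      (fun x hx => ?_) (by simp) x hx
    rw [exp_sub, exp_log (ha x hx), exp_log (hb x hx)]
  · refine eq_log_of_exp_eq_on_segment (g := fun x => y * (1 - x / y) / (1 - x))
      (h := fun x => log y + log (1 - x / y) - log (1 - x))
      ((continuousOn_const.mul pc).div pa ha) ((continuousOn_const.add cc).sub ca)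
      (fun x hx => (hseg x hx).mul_quot_div) (fun x hx => ?_) (by simp) x hx
    rw [exp_sub, exp_add, exp_log (ha x hx), exp_log (hc x hx), exp_log hy0]
  · refine eq_log_of_exp_eq_on_segment (g := fun x => (1 - x * y) / (y * (1 - x)))
      (h := fun x => log (1 - x * y) - log (1 - x) - log y)
      (pb.div (continuousOn_const.mul pa) fun x hx => mul_ne_zero hy0 (ha x hx))
      ((cb.sub ca).sub continuousOn_const)
      (fun x hx => (hseg x hx).quot_quot) (fun x hx => ?_)
      (by simpa using log_inv_of_mem_slitPlane hy) x hx
    rw [exp_sub, exp_sub, exp_log (ha x hx), exp_log (hb x hx), exp_log hy0, div_div, mul_comm y]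

lemma kummer_mem_cutPlane {y x₀ : ℂ} (hy : y ∈ slitPlane)
    (hseg : ∀ x ∈ segment ℝ 0 x₀, KummerAdmissible y x) {x : ℂ} (hx : x ∈ segment ℝ 0 x₀) :
    x * (1 - y) ^ 2 / (y * (1 - x) ^ 2) ∈ cutPlane ∧ x * y ∈ cutPlane ∧ x / y ∈ cutPlane ∧
    x * (1 - y) / (y * (1 - x)) ∈ cutPlane ∧ -(x * (1 - y)) / (1 - x) ∈ cutPlane ∧
    (1 - y) / (1 - x) ∈ cutPlane ∧ -(1 - y) / (y * (1 - x)) ∈ cutPlane ∧ x ∈ cutPlane := by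
  have hy0 := slitPlane_ne_zero hy
  have h := hseg x hx
  have ha := slitPlane_ne_zero h.one_sub
  simp only [cutPlane, mem_ofPred_eq, one_sub_kummer_sq hy0 ha, one_sub_kummer_div hy0 ha,
    one_sub_kummer_mul ha, one_sub_kummer_quot hy0 ha, one_sub_kummer_neg_quot hy0 ha]
  exact ⟨h.quot_mul, h.one_sub_mul, h.one_sub_div, h.quot_div, h.quot, h.mul_quot_div,
    h.quot_quot, h.one_sub⟩

lemma continuousOn_kummer {y x₀ : ℂ} (hy : y ∈ slitPlane)
    (hseg : ∀ x ∈ segment ℝ 0 x₀, KummerAdmissible y x) :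
    ContinuousOn (fun x => x * (1 - y) ^ 2 / (y * (1 - x) ^ 2)) (segment ℝ 0 x₀) ∧
    ContinuousOn (fun x => x * (1 - y) / (y * (1 - x))) (segment ℝ 0 x₀) ∧
    ContinuousOn (fun x => -(x * (1 - y)) / (1 - x)) (segment ℝ 0 x₀) ∧
    ContinuousOn (fun x => (1 - y) / (1 - x)) (segment ℝ 0 x₀) ∧
    ContinuousOn (fun x => -(1 - y) / (y * (1 - x))) (segment ℝ 0 x₀) := by
  have hy0 := slitPlane_ne_zero hy
  have ha : ∀ x ∈ segment ℝ 0 x₀, 1 - x ≠ 0 := fun x hx => slitPlane_ne_zero (hseg x hx).one_sub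
  refine ⟨?_, ?_, ?_, ?_, ?_⟩
  · exact ContinuousOn.div (by fun_prop) (by fun_prop)
      fun x hx => mul_ne_zero hy0 (pow_ne_zero 2 (ha x hx))
  · exact ContinuousOn.div (by fun_prop) (by fun_prop) fun x hx => mul_ne_zero hy0 (ha x hx)
  · exact ContinuousOn.div (by fun_prop) (by fun_prop) ha
  · exact ContinuousOn.div (by fun_prop) (by fun_prop) ha
  · exact ContinuousOn.div (by fun_prop) (by fun_prop) fun x hx => mul_ne_zero hy0 (ha x hx)

/-- This is the coefficient of `x⁻¹` in the derivative of the Spence–Kummer combination. After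
splitting the logarithms its own derivative cancels, and every argument is 0 at `x = 0`. -/
lemma dilog_kummer_six_term {y x₀ : ℂ} (hy : y ∈ slitPlane)
    (hseg : ∀ x ∈ segment ℝ 0 x₀, KummerAdmissible y x) (hy1 : y ≠ 1) (hx0 : x₀ ≠ 0) :
    dilog (x₀ * (1 - y) ^ 2 / (y * (1 - x₀) ^ 2)) + dilog (x₀ * y) + dilog (x₀ / y)
      - 2 * dilog (x₀ * (1 - y) / (y * (1 - x₀))) - 2 * dilog (-(x₀ * (1 - y)) / (1 - x₀))
      - 2 * dilog x₀ = 0 := by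
  have hy0 := slitPlane_ne_zero hy
  have hy1' : 1 - y ≠ 0 := sub_ne_zero.2 hy1.symm
  have hm := fun x hx => kummer_mem_cutPlane hy hseg (x := x) hx
  obtain ⟨c1, c4, c5, -, -⟩ := continuousOn_kummer hy hseg
  have h := eq_of_hasDerivAt_zero_on_openSegment
    (f := fun x => dilog (x * (1 - y) ^ 2 / (y * (1 - x) ^ 2)) + dilog (x * y) + dilog (x / y)
      - 2 * dilog (x * (1 - y) / (y * (1 - x))) - 2 * dilog (-(x * (1 - y)) / (1 - x))
      - 2 * dilog x) (p := 0) (q := x₀) ?_ ?_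
  · simpa [dilog_zero] using h
  · exact (((((continuousOn_dilog_comp c1 fun x hx => (hm x hx).1).add
      (continuousOn_dilog_comp (by fun_prop) fun x hx => (hm x hx).2.1)).add
      (continuousOn_dilog_comp (by fun_prop) fun x hx => (hm x hx).2.2.1)).sub
      (continuousOn_const.mul (continuousOn_dilog_comp c4 fun x hx => (hm x hx).2.2.2.1))).sub
      (continuousOn_const.mul (continuousOn_dilog_comp c5 fun x hx => (hm x hx).2.2.2.2.1))).sub
      (continuousOn_const.mul
        (continuousOn_dilog_comp (by fun_prop) fun x hx => (hm x hx).2.2.2.2.2.2.2))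
  · intro x hx
    have hxs := openSegment_subset_segment ℝ _ _ hx
    have hx0' := ne_zero_of_mem_openSegment_zero hx0 hx
    have ha := slitPlane_ne_zero (hseg x hxs).one_sub
    obtain ⟨m1, m2, m3, m4, m5, -, -, m8⟩ := hm x hxs
    have d1 := hasDerivAt_dilog_comp (hasDerivAt_kummer_sq hy0 hx0' ha) m1 (by positivity)
    have d2 := hasDerivAt_dilog_comp (hasDerivAt_mul_logDeriv (y := y) hx0') m2 (by positivity)
    have d3 := hasDerivAt_dilog_comp (hasDerivAt_div_logDeriv (y := y) hx0') m3 (by positivity)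
    have d4 := hasDerivAt_dilog_comp (hasDerivAt_kummer_div hy0 hx0' ha) m4 (by positivity)
    have d5 := hasDerivAt_dilog_comp (hasDerivAt_kummer_mul hx0' ha) m5
      (div_ne_zero (neg_ne_zero.2 (mul_ne_zero hx0' hy1')) ha)
    have d8 := hasDerivAt_dilog_comp (hasDerivAt_id_logDeriv hx0') m8 hx0'
    refine (((((d1.add d2).add d3).sub (d4.const_mul 2)).sub (d5.const_mul 2)).sub
      (d8.const_mul 2)).congr_deriv ?_
    obtain ⟨l1, l4, l5, -, -⟩ := log_kummer hy hseg hxs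
    rw [one_sub_kummer_sq hy0 ha, one_sub_kummer_div hy0 ha, one_sub_kummer_mul ha, l1, l4, l5]
    ring

/-- This is the coefficient of `2 * (1 - x)⁻¹` in the derivative of the Spence–Kummer combination.
At `x = 0` only the arguments `1 - y` and `1 - y⁻¹` survive, so the constant comes from Landen's
equation. -/
lemma dilog_kummer_five_term {y x₀ : ℂ} (hy : y ∈ slitPlane)
    (hseg : ∀ x ∈ segment ℝ 0 x₀, KummerAdmissible y x) (hy1 : y ≠ 1) (hx0 : x₀ ≠ 0) :
    dilog (x₀ * (1 - y) ^ 2 / (y * (1 - x₀) ^ 2)) - dilog (x₀ * (1 - y) / (y * (1 - x₀)))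
      - dilog (-(x₀ * (1 - y)) / (1 - x₀)) - dilog ((1 - y) / (1 - x₀))
      - dilog (-(1 - y) / (y * (1 - x₀))) = log y ^ 2 / 2 := by
  have hy0 := slitPlane_ne_zero hy
  have hy1' : 1 - y ≠ 0 := sub_ne_zero.2 hy1.symm
  have hm := fun x hx => kummer_mem_cutPlane hy hseg (x := x) hx
  obtain ⟨c1, c4, c5, c6, c7⟩ := continuousOn_kummer hy hseg
  have h := eq_of_hasDerivAt_zero_on_openSegment
    (f := fun x => dilog (x * (1 - y) ^ 2 / (y * (1 - x) ^ 2))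
      - dilog (x * (1 - y) / (y * (1 - x))) - dilog (-(x * (1 - y)) / (1 - x))
      - dilog ((1 - y) / (1 - x)) - dilog (-(1 - y) / (y * (1 - x)))) (p := 0) (q := x₀) ?_ ?_
  · simp only [zero_mul, zero_div, dilog_zero, neg_zero, sub_zero, div_one, mul_one] at h
    have e : -(1 - y) / y = 1 - y⁻¹ := by field_simp; ring
    rw [e] at h
    rw [h]
    linear_combination -dilog_landen hy
  · exact ((((continuousOn_dilog_comp c1 fun x hx => (hm x hx).1).sub
      (continuousOn_dilog_comp c4 fun x hx => (hm x hx).2.2.2.1)).sub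
      (continuousOn_dilog_comp c5 fun x hx => (hm x hx).2.2.2.2.1)).sub
      (continuousOn_dilog_comp c6 fun x hx => (hm x hx).2.2.2.2.2.1)).sub
      (continuousOn_dilog_comp c7 fun x hx => (hm x hx).2.2.2.2.2.2.1)
  · intro x hx
    have hxs := openSegment_subset_segment ℝ _ _ hx
    have hx0' := ne_zero_of_mem_openSegment_zero hx0 hx
    have ha := slitPlane_ne_zero (hseg x hxs).one_sub
    obtain ⟨m1, -, -, m4, m5, m6, m7, -⟩ := hm x hxs
    have d1 := hasDerivAt_dilog_comp (hasDerivAt_kummer_sq hy0 hx0' ha) m1 (by positivity)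
    have d4 := hasDerivAt_dilog_comp (hasDerivAt_kummer_div hy0 hx0' ha) m4 (by positivity)
    have d5 := hasDerivAt_dilog_comp (hasDerivAt_kummer_mul hx0' ha) m5
      (div_ne_zero (neg_ne_zero.2 (mul_ne_zero hx0' hy1')) ha)
    have d6 := hasDerivAt_dilog_comp (hasDerivAt_kummer_quot ha) m6 (by positivity)
    have d7 := hasDerivAt_dilog_comp (hasDerivAt_kummer_neg_quot hy0 ha) m7
      (div_ne_zero (neg_ne_zero.2 hy1') (mul_ne_zero hy0 ha))
    refine ((((d1.sub d4).sub d5).sub d6).sub d7).congr_deriv ?_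
    obtain ⟨l1, l4, l5, l6, l7⟩ := log_kummer hy hseg hxs
    rw [one_sub_kummer_sq hy0 ha, one_sub_kummer_div hy0 ha, one_sub_kummer_mul ha,
      one_sub_kummer_quot hy0 ha, one_sub_kummer_neg_quot hy0 ha, l1, l4, l5, l6, l7]
    ring

/-- The Spence–Kummer relation for the trilogarithm. -/
theorem trilog_spence_kummer {y x₀ : ℂ} (hy : y ∈ slitPlane)
    (hseg : ∀ x ∈ segment ℝ 0 x₀, KummerAdmissible y x) (hyn : ‖y‖ < 1) (hx0 : x₀ ≠ 0) :
    trilog (x₀ * (1 - y) ^ 2 / (y * (1 - x₀) ^ 2)) + trilog (x₀ * y) + trilog (x₀ / y)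
      - 2 * trilog (x₀ * (1 - y) / (y * (1 - x₀))) - 2 * trilog (-(x₀ * (1 - y)) / (1 - x₀))
      - 2 * trilog ((1 - y) / (1 - x₀)) - 2 * trilog (-(1 - y) / (y * (1 - x₀)))
      - 2 * trilog x₀ - 2 * trilog y + 2 * Li 3 1
    = log y ^ 2 * (log (1 - y) - log (1 - x₀)) - (Real.pi : ℂ) ^ 2 / 3 * log y
      - log y ^ 3 / 3 := by
  have hy0 := slitPlane_ne_zero hy
  have hy1 : y ≠ 1 := by rintro rfl; simp at hyn
  have hy1' : 1 - y ≠ 0 := sub_ne_zero.2 hy1.symm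
  have hm := fun x hx => kummer_mem_cutPlane hy hseg (x := x) hx
  obtain ⟨c1, c4, c5, c6, c7⟩ := continuousOn_kummer hy hseg
  have ca := (continuousOn_log_kummer hseg).1
  have h := eq_of_hasDerivAt_zero_on_openSegment
    (f := fun x => trilog (x * (1 - y) ^ 2 / (y * (1 - x) ^ 2)) + trilog (x * y) + trilog (x / y)
      - 2 * trilog (x * (1 - y) / (y * (1 - x))) - 2 * trilog (-(x * (1 - y)) / (1 - x))
      - 2 * trilog ((1 - y) / (1 - x)) - 2 * trilog (-(1 - y) / (y * (1 - x)))
      - 2 * trilog x + log y ^ 2 * log (1 - x)) (p := 0) (q := x₀) ?_ ?_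
  · simp only [zero_mul, zero_div, trilog_zero, neg_zero, sub_zero, div_one, mul_one, log_one]
      at h
    have e : -(1 - y) / y = 1 - y⁻¹ := by field_simp; ring
    rw [e] at h
    -- At `x = 0` there remains `-2 * (trilog (1 - y) + trilog (1 - y⁻¹))`, which Landen's equation
    -- evaluates through `trilog y`, `Li 3 1` and logarithms.
    linear_combination h - 2 * trilog_landen hyn hy
  · exact ((((((((continuousOn_trilog_comp c1 fun x hx => (hm x hx).1).add
      (continuousOn_trilog_comp (by fun_prop) fun x hx => (hm x hx).2.1)).add
      (continuousOn_trilog_comp (by fun_prop) fun x hx => (hm x hx).2.2.1)).sub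
      (continuousOn_const.mul (continuousOn_trilog_comp c4 fun x hx => (hm x hx).2.2.2.1))).sub
      (continuousOn_const.mul (continuousOn_trilog_comp c5 fun x hx => (hm x hx).2.2.2.2.1))).sub
      (continuousOn_const.mul
        (continuousOn_trilog_comp c6 fun x hx => (hm x hx).2.2.2.2.2.1))).sub
      (continuousOn_const.mul
        (continuousOn_trilog_comp c7 fun x hx => (hm x hx).2.2.2.2.2.2.1))).sub
      (continuousOn_const.mul
        (continuousOn_trilog_comp (by fun_prop) fun x hx => (hm x hx).2.2.2.2.2.2.2))).add
      (continuousOn_const.mul ca)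
  · intro x hx
    have hxs := openSegment_subset_segment ℝ _ _ hx
    have hx0' := ne_zero_of_mem_openSegment_zero hx0 hx
    have ha := slitPlane_ne_zero (hseg x hxs).one_sub
    -- The dilogarithm relations are needed at every intermediate `x`, hence on the shortened
    -- segment.
    have hseg' : ∀ w ∈ segment ℝ 0 x, KummerAdmissible y w := fun w hw => hseg w
      ((convex_segment (0 : ℂ) x₀).segment_subset (left_mem_segment ℝ 0 x₀) hxs hw)
    obtain ⟨m1, m2, m3, m4, m5, m6, m7, m8⟩ := hm x hxs
    have d1 := hasDerivAt_trilog_comp (hasDerivAt_kummer_sq hy0 hx0' ha) m1 (by positivity)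
    have d2 := hasDerivAt_trilog_comp (hasDerivAt_mul_logDeriv (y := y) hx0') m2 (by positivity)
    have d3 := hasDerivAt_trilog_comp (hasDerivAt_div_logDeriv (y := y) hx0') m3 (by positivity)
    have d4 := hasDerivAt_trilog_comp (hasDerivAt_kummer_div hy0 hx0' ha) m4 (by positivity)
    have d5 := hasDerivAt_trilog_comp (hasDerivAt_kummer_mul hx0' ha) m5
      (div_ne_zero (neg_ne_zero.2 (mul_ne_zero hx0' hy1')) ha)
    have d6 := hasDerivAt_trilog_comp (hasDerivAt_kummer_quot ha) m6 (by positivity)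
    have d7 := hasDerivAt_trilog_comp (hasDerivAt_kummer_neg_quot hy0 ha) m7
      (div_ne_zero (neg_ne_zero.2 hy1') (mul_ne_zero hy0 ha))
    have d8 := hasDerivAt_trilog_comp (hasDerivAt_id_logDeriv hx0') m8 hx0'
    have da : HasDerivAt (fun x : ℂ => log (1 - x)) (-1 / (1 - x)) x :=
      ((hasDerivAt_id x).const_sub 1).clog m8
    refine (((((((((d1.add d2).add d3).sub (d4.const_mul 2)).sub (d5.const_mul 2)).sub
      (d6.const_mul 2)).sub (d7.const_mul 2)).sub (d8.const_mul 2)).add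
      (da.const_mul (log y ^ 2)))).congr_deriv ?_
    linear_combination x⁻¹ * dilog_kummer_six_term hy hseg' hy1 hx0'
      + 2 * (1 - x)⁻¹ * dilog_kummer_five_term hy hseg' hy1 hx0'

/-! ### Admissibility of the three specializations -/

/-- The slit plane is stable under positive scaling, so a quotient can be tested after clearing a
positive real denominator. -/
lemma mem_slitPlane_of_mul_eq {z : ℂ} {r a b : ℝ} (hr : 0 < r) (h : z * r = a + b * I)
    (hab : 0 < a ∨ b ≠ 0) : z ∈ slitPlane := by
  have hre := congrArg re h
  have him := congrArg im h
  simp at hre him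
  rcases hab with h | h
  · left
    rw [← hre] at h
    exact pos_of_mul_pos_left h hr.le
  · right
    rintro h0
    exact h (by rw [← him, h0, zero_mul])

lemma ofReal_div_mem_slitPlane {a b : ℝ} (ha : 0 < a) (hb : 0 < b) :
    (a : ℂ) / (b : ℂ) ∈ slitPlane := by
  rw [← ofReal_div, ofReal_mem_slitPlane]
  positivity

lemma kummerAdmissible_half_neg_one {x : ℂ} (hx : x ∈ segment ℝ 0 (-1 : ℂ)) :
    KummerAdmissible (1 / 2) x := by
  rw [segment_eq_image'] at hx
  obtain ⟨s, ⟨hs, -⟩, rfl⟩ := hx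
  have e : (0 : ℂ) + s • (-1 - 0) = -(s : ℂ) := by simp
  simp only [e]
  have h1 : (1 : ℂ) - -(s : ℂ) = ((1 + s : ℝ) : ℂ) := by push_cast; ring
  have h2 : (1 : ℂ) - -(s : ℂ) * (1 / 2) = ((1 + s / 2 : ℝ) : ℂ) := by push_cast; ring
  have h3 : (1 : ℂ) - -(s : ℂ) / (1 / 2) = ((1 + 2 * s : ℝ) : ℂ) := by push_cast; ring
  have h4 : (1 / 2 : ℂ) = ((1 / 2 : ℝ) : ℂ) := by push_cast; ring
  constructor <;> simp only [h1, h2, h3]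
  · rw [ofReal_mem_slitPlane]; positivity
  · rw [ofReal_mem_slitPlane]; positivity
  · rw [ofReal_mem_slitPlane]; positivity
  · rw [← ofReal_mul, ← ofReal_pow]
    exact ofReal_div_mem_slitPlane (by positivity) (by positivity)
  · exact ofReal_div_mem_slitPlane (by positivity) (by positivity)
  · exact ofReal_div_mem_slitPlane (by positivity) (by positivity)
  · rw [h4, ← ofReal_mul]
    exact ofReal_div_mem_slitPlane (by positivity) (by positivity)
  · rw [h4, ← ofReal_mul]
    exact ofReal_div_mem_slitPlane (by positivity) (by positivity)

lemma one_add_I_ne_zero : (1 + I : ℂ) ≠ 0 := fun h => by simpa using congrArg re h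

lemma one_add_I_inv : (1 + I : ℂ)⁻¹ = (1 - I) / 2 := by
  rw [inv_eq_iff_eq_inv, eq_comm]
  refine inv_eq_of_mul_eq_one_right ?_
  linear_combination (-1 / 2 : ℂ) * I_sq

lemma kummerAdmissible_one_add_I_div_two_neg_one {x : ℂ} (hx : x ∈ segment ℝ 0 (-1 : ℂ)) :
    KummerAdmissible ((1 + I) / 2) x := by
  rw [segment_eq_image'] at hx
  obtain ⟨s, ⟨hs, -⟩, rfl⟩ := hx
  have e : (0 : ℂ) + s • (-1 - 0) = -(s : ℂ) := by simp
  simp only [e]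
  have hs1 : 0 < 1 + s := by positivity
  have hs1' : (1 + s : ℂ) ≠ 0 := by exact_mod_cast hs1.ne'
  have h1 : (1 : ℂ) - -(s : ℂ) = 1 + s := by ring
  have h2 : (1 : ℂ) - -(s : ℂ) * ((1 + I) / 2) = 1 + s / 2 + s / 2 * I := by ring
  have h3 : (1 : ℂ) - -(s : ℂ) / ((1 + I) / 2) = 1 + s - s * I := by
    rw [div_div_eq_mul_div, div_eq_mul_inv, one_add_I_inv]; ring
  have hy : ((1 + I : ℂ) / 2) * (1 + s - s * I) = 1 / 2 + s + 1 / 2 * I := by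
    linear_combination (-s / 2 : ℂ) * I_sq
  have hI := one_add_I_ne_zero
  constructor <;> simp only [h1, h2, h3]
  · exact mem_slitPlane_of_mul_eq (r := 1) (a := 1 + s) (b := 0) one_pos (by push_cast; ring)
      (Or.inl hs1)
  · exact mem_slitPlane_of_mul_eq (r := 1) (a := 1 + s / 2) (b := s / 2) one_pos
      (by push_cast; ring) (Or.inl (by positivity))
  · exact mem_slitPlane_of_mul_eq (r := 1) (a := 1 + s) (b := -s) one_pos
      (by push_cast; ring) (Or.inl hs1)
  · refine mem_slitPlane_of_mul_eq (r := (1 + s) ^ 2) (a := (1 + s) * (1 + s / 2) + s ^ 2 / 2)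
      (b := (1 + s) * (s / 2) - s * (1 + s / 2)) (by positivity) ?_ (Or.inl (by positivity))
    push_cast
    rw [div_mul_cancel₀ _ (pow_ne_zero 2 hs1')]
    linear_combination (-s ^ 2 / 2 : ℂ) * I_sq
  · refine mem_slitPlane_of_mul_eq (r := 1 + s) (a := 1 + s) (b := -s) hs1 ?_ (Or.inl hs1)
    push_cast
    rw [div_mul_cancel₀ _ hs1']
    ring
  · refine mem_slitPlane_of_mul_eq (r := 1 + s) (a := 1 + s / 2) (b := s / 2) hs1 ?_
      (Or.inl (by positivity))
    push_cast
    rw [div_mul_cancel₀ _ hs1']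
  · refine mem_slitPlane_of_mul_eq (r := 1 + s) (a := 1 / 2 + s) (b := 1 / 2) hs1 ?_
      (Or.inl (by positivity))
    push_cast
    rw [div_mul_cancel₀ _ hs1', hy]
  · refine mem_slitPlane_of_mul_eq (r := 1 + s) (a := 1 + s) (b := -1) hs1 ?_
      (Or.inl (by positivity))
    push_cast
    field_simp
    linear_combination I_sq

lemma kummerAdmissible_half_one_sub_I {x : ℂ} (hx : x ∈ segment ℝ 0 (1 - I)) :
    KummerAdmissible (1 / 2) x := by
  rw [segment_eq_image'] at hx
  obtain ⟨s, ⟨hs, hs1⟩, rfl⟩ := hx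
  have e : (0 : ℂ) + s • (1 - I - 0) = (s : ℂ) * (1 - I) := by simp
  simp only [e]
  have hr : 0 < (1 - s) ^ 2 + s ^ 2 := by nlinarith [sq_nonneg (1 - 2 * s)]
  have hne : (1 : ℂ) - s + s * I ≠ 0 := by
    intro h
    have hre := congrArg re h
    have him := congrArg im h
    simp at hre him
    rw [him] at hre
    norm_num at hre
  have hconj : ((1 - s) ^ 2 + s ^ 2 : ℂ) = (1 - s + s * I) * (1 - s - s * I) := by
    linear_combination (s ^ 2 : ℂ) * I_sq
  have h1 : (1 : ℂ) - s * (1 - I) = 1 - s + s * I := by ring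
  have h2 : (1 : ℂ) - s * (1 - I) * (1 / 2) = 1 - s / 2 + s / 2 * I := by ring
  have h3 : (1 : ℂ) - s * (1 - I) / (1 / 2) = 1 - 2 * s + 2 * s * I := by ring
  -- When the scaled imaginary part is `s`, the real part matters only at the starting point `s =
  -- 0`.
  have hcase : ∀ {a b : ℝ}, (s = 0 → 0 < a) → b = s → 0 < a ∨ b ≠ 0 := by
    intro a b ha hb
    rcases eq_or_ne s 0 with h | h
    · exact Or.inl (ha h)
    · exact Or.inr (hb ▸ h)
  constructor <;> simp only [h1, h2, h3]
  · exact mem_slitPlane_of_mul_eq (r := 1) (a := 1 - s) (b := s) one_pos (by push_cast; ring)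
      (hcase (by rintro rfl; norm_num) rfl)
  · exact mem_slitPlane_of_mul_eq (r := 2) (a := 2 - s) (b := s) two_pos
      (by push_cast; ring) (hcase (by rintro rfl; norm_num) rfl)
  · exact mem_slitPlane_of_mul_eq (r := 1 / 2) (a := 1 / 2 - s) (b := s) (by norm_num)
      (by push_cast; ring) (hcase (by rintro rfl; norm_num) rfl)
  · refine mem_slitPlane_of_mul_eq (r := ((1 - s) ^ 2 + s ^ 2) ^ 2)
      (a := 1 - 9 / 2 * s + 10 * s ^ 2 - 9 * s ^ 3 + 4 * s ^ 4)
      (b := s * (1 / 2 - s ^ 2)) (by positivity) ?_ ?_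
    · push_cast
      rw [hconj]
      field_simp
      ring_nf
      simp only [I_sq, I_pow_three, I_pow_four]
      ring
    -- The curve meets the real axis again at `s ^ 2 = 1 / 2`, where the real part is `7 - 9 * s >
    -- 0`.
    · by_cases hb : s * (1 / 2 - s ^ 2) = 0
      · left
        rcases mul_eq_zero.1 hb with h | h
        · rw [h]; norm_num
        · have h2 : s ^ 2 = 1 / 2 := by linarith
          have h3 : s ^ 3 = s / 2 := by rw [pow_succ, h2]; ring
          have h4 : s ^ 4 = 1 / 4 := by rw [show s ^ 4 = (s ^ 2) ^ 2 by ring, h2]; norm_num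
          rw [h2, h3, h4]
          nlinarith
      · exact Or.inr hb
  · refine mem_slitPlane_of_mul_eq (r := (1 - s) ^ 2 + s ^ 2)
      (a := (1 - 2 * s) * (1 - s) + 2 * s ^ 2) (b := s) hr ?_ (hcase (by rintro rfl; norm_num) rfl)
    push_cast
    rw [hconj]
    field_simp
    linear_combination (-2 * s ^ 2 : ℂ) * I_sq
  · refine mem_slitPlane_of_mul_eq (r := 2 * ((1 - s) ^ 2 + s ^ 2))
      (a := (2 - s) * (1 - s) + s ^ 2) (b := -s) (by positivity) ?_
      (Or.inl (by nlinarith))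
    push_cast
    rw [hconj]
    field_simp
    linear_combination (-s ^ 2 : ℂ) * I_sq
  · refine mem_slitPlane_of_mul_eq (r := 2 * ((1 - s) ^ 2 + s ^ 2))
      (a := (1 - 2 * s) * (1 - s) + 2 * s ^ 2) (b := s) (by positivity) ?_
      (hcase (by rintro rfl; norm_num) rfl)
    push_cast
    rw [hconj]
    field_simp
    linear_combination (-2 * s ^ 2 : ℂ) * I_sq
  · refine mem_slitPlane_of_mul_eq (r := (1 - s) ^ 2 + s ^ 2)
      (a := (2 - s) * (1 - s) + s ^ 2) (b := -s) hr ?_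
      (Or.inl (by nlinarith))
    push_cast
    rw [hconj]
    field_simp
    linear_combination (-s ^ 2 : ℂ) * I_sq

/-! ### Special values of the logarithm and norms -/

lemma log_half : log (1 / 2 : ℂ) = -(Real.log 2 : ℂ) := by
  rw [one_div, log_inv_of_mem_slitPlane (by simp)]
  simp

lemma log_two : log (2 : ℂ) = (Real.log 2 : ℂ) := by
  simp

lemma exp_pi_div_four_mul_I : exp ((Real.pi / 4 : ℝ) * I) = ((√2 / 2 : ℝ) : ℂ) * (1 + I) := by
  rw [exp_mul_I, ← ofReal_cos, ← ofReal_sin, Real.cos_pi_div_four, Real.sin_pi_div_four]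
  ring

lemma sqrt_two_mul_half : ((√2 : ℝ) : ℂ) * ((√2 / 2 : ℝ) : ℂ) = 1 := by
  rw [← ofReal_mul, mul_div_assoc', Real.mul_self_sqrt (by norm_num)]
  norm_num

lemma log_one_add_I : log (1 + I) = (Real.log 2 : ℂ) / 2 + Real.pi / 4 * I := by
  have h : (1 + I : ℂ) = (√2 : ℝ) * exp ((Real.pi / 4 : ℝ) * I) := by
    rw [exp_pi_div_four_mul_I, ← mul_assoc, sqrt_two_mul_half, one_mul]
  have hpi := Real.pi_pos
  rw [h, log_ofReal_mul (by positivity) (exp_ne_zero _), log_exp (by simp; linarith)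
    (by simp; linarith), Real.log_sqrt (by norm_num)]
  push_cast
  ring

lemma log_neg_one_add_I : log (-1 + I) = (Real.log 2 : ℂ) / 2 + 3 * Real.pi / 4 * I := by
  have h : (-1 + I : ℂ) = (√2 : ℝ) * exp ((3 * Real.pi / 4 : ℝ) * I) := by
    rw [show ((3 * Real.pi / 4 : ℝ) : ℂ) * I = (Real.pi / 4 : ℝ) * I + Real.pi / 2 * I by
      push_cast; ring, exp_add, exp_pi_div_four_mul_I, exp_pi_div_two_mul_I]
    linear_combination (-(-1 + I)) * sqrt_two_mul_half
      - ((√2 : ℝ) : ℂ) * ((√2 / 2 : ℝ) : ℂ) * I_sq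
  have hpi := Real.pi_pos
  rw [h, log_ofReal_mul (by positivity) (exp_ne_zero _), log_exp (by simp; linarith)
    (by simp; linarith), Real.log_sqrt (by norm_num)]
  push_cast
  ring

lemma log_one_sub_I : log (1 - I) = (Real.log 2 : ℂ) / 2 - Real.pi / 4 * I := by
  have h : (1 - I : ℂ) = (starRingEnd ℂ) (1 + I) := by simp [sub_eq_add_neg]
  rw [h, log_conj _ (mem_slitPlane_iff_arg.1 (Or.inl (by simp))).1, log_one_add_I]
  simp only [map_add, map_mul, map_div₀, conj_ofReal, conj_I, map_ofNat]
  ring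

lemma log_div_two {z : ℂ} (hz : z ≠ 0) : log (z / 2) = log z - (Real.log 2 : ℂ) := by
  have : z / 2 = ((1 / 2 : ℝ) : ℂ) * z := by push_cast; ring
  rw [this, log_ofReal_mul (by norm_num) hz, one_div, Real.log_inv]
  push_cast
  ring

lemma log_neg_two_add_two_I :
    log (-2 + 2 * I) = 3 * (Real.log 2 : ℂ) / 2 + 3 * Real.pi / 4 * I := by
  have : (-2 + 2 * I : ℂ) = ((2 : ℝ) : ℂ) * (-1 + I) := by push_cast; ring
  rw [this, log_ofReal_mul (by norm_num) (fun h => by simpa using congrArg im h),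
    log_neg_one_add_I]
  ring

lemma norm_one_add_I_sq : ‖(1 + I : ℂ)‖ ^ 2 = 2 := by
  rw [← normSq_eq_norm_sq]; simp [normSq_apply]; norm_num

lemma norm_one_add_I_lt_two : ‖(1 + I : ℂ)‖ < 2 := by
  nlinarith [norm_one_add_I_sq, norm_nonneg (1 + I : ℂ)]

lemma norm_one_add_I_div_lt_one {r : ℝ} (hr : 2 ≤ r) : ‖(1 + I : ℂ) / r‖ < 1 := by
  rw [norm_div, norm_real, Real.norm_of_nonneg (by linarith), div_lt_one (by linarith)]
  linarith [norm_one_add_I_lt_two]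

lemma trilog_eq_Li_of_norm_lt_one {z : ℂ} (hz : ‖z‖ < 1) : trilog z = Li 3 z :=
  trilog_eq_Li hz.le (by rintro rfl; simp at hz)

lemma norm_one_add_I_div_two_lt_one : ‖(1 + I : ℂ) / 2‖ < 1 := by
  simpa using norm_one_add_I_div_lt_one (le_refl 2)

lemma conj_one_add_I_div (r : ℂ) (hr : (starRingEnd ℂ) r = r) :
    (starRingEnd ℂ) ((1 + I) / r) = (1 - I) / r := by
  simp [hr, sub_eq_add_neg]

/-! ### Special values and relations of the trilogarithm -/

lemma Li_one_sub_I_div_two (n : ℕ) :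
    Li n ((1 - I) / 2) = (starRingEnd ℂ) (Li n ((1 + I) / 2)) := by
  rw [← Li_conj, conj_one_add_I_div _ (map_ofNat _ 2)]

lemma Li_one_sub_I_div_four (n : ℕ) :
    Li n ((1 - I) / 4) = (starRingEnd ℂ) (Li n ((1 + I) / 4)) := by
  rw [← Li_conj, conj_one_add_I_div _ (map_ofNat _ 4)]

lemma Li_one_sub_I_div_eight (n : ℕ) :
    Li n ((1 - I) / 8) = (starRingEnd ℂ) (Li n ((1 + I) / 8)) := by
  rw [← Li_conj, conj_one_add_I_div _ (map_ofNat _ 8)]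

lemma Li_neg_one_sub_I_div_two (n : ℕ) :
    Li n (-((1 - I) / 2)) = (starRingEnd ℂ) (Li n (-((1 + I) / 2))) := by
  rw [← Li_conj, map_neg, conj_one_add_I_div _ (map_ofNat _ 2)]

lemma Li_neg_I_div_two (n : ℕ) :
    Li n (-I / 2) = (starRingEnd ℂ) (Li n (I / 2)) := by
  rw [← Li_conj, map_div₀, conj_I, map_ofNat]

lemma Li_neg_I (n : ℕ) : Li n (-I) = (starRingEnd ℂ) (Li n I) := by
  rw [← Li_conj, conj_I]

lemma Li_three_neg_one : Li 3 (-1) = -3 / 4 * Li 3 1 := by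
  have := Li_neg_one (n := 3) (by norm_num)
  linear_combination this / 8

lemma Li_three_I_add_conj : Li 3 I + (starRingEnd ℂ) (Li 3 I) = -3 / 16 * Li 3 1 := by
  have := Li_sq (n := 3) (z := I) (by norm_num) (by simp)
  rw [I_sq, Li_neg_I, Li_three_neg_one] at this
  linear_combination -this / 8

lemma Li_three_neg_one_add_I_div_two :
    Li 3 (-((1 + I) / 2)) = Li 3 (I / 2) / 4 - Li 3 ((1 + I) / 2) := by
  have := Li_sq (n := 3) (z := (1 + I) / 2) (by norm_num) norm_one_add_I_div_two_lt_one.le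
  rw [show ((1 + I) / 2) ^ 2 = I / 2 by linear_combination I_sq / 4] at this
  linear_combination -this / 8

lemma Li_three_quarter : Li 3 (1 / 4) = 4 * (Li 3 (1 / 2) + Li 3 (-1 / 2)) := by
  have := Li_sq (n := 3) (z := 1 / 2) (by norm_num) (by norm_num)
  rw [show (1 / 2 : ℂ) ^ 2 = 1 / 4 by norm_num, show -(1 / 2 : ℂ) = -1 / 2 by ring] at this
  linear_combination this / 2

/-- Inversion at `x = -I` exchanges `I` and `-I`, so their difference is elementary. -/
lemma Li_three_I_sub_conj : Li 3 I - (starRingEnd ℂ) (Li 3 I) = (Real.pi : ℂ) ^ 3 / 16 * I := by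
  have h := trilog_inversion (x := -I) (Or.inr (by simp))
  rw [inv_neg, inv_I, neg_neg, trilog_eq_Li (by simp) (fun h => by simpa using congrArg re h),
    trilog_eq_Li (by simp) (fun h => by simpa using congrArg re h), Li_neg_I, log_neg_I] at h
  have h3 := I_pow_three
  linear_combination h + (Real.pi : ℂ) ^ 3 / 48 * h3

lemma Li_three_half :
    2 * Li 3 (1 / 2) = 7 / 4 * Li 3 1 + (Real.log 2 : ℂ) ^ 3 / 3
      - (Real.pi : ℂ) ^ 2 / 6 * (Real.log 2 : ℂ) := by
  have h := trilog_landen (z := 1 / 2) (by norm_num) (Or.inl (by norm_num))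
  rw [show (1 : ℂ) - 1 / 2 = 1 / 2 by norm_num, show (1 : ℂ) - (1 / 2)⁻¹ = -1 by norm_num,
    trilog_eq_Li_of_norm_lt_one (by norm_num), trilog_eq_Li (by simp) (by norm_num),
    Li_three_neg_one, log_half] at h
  linear_combination h

lemma inv_one_add_I_div_two : ((1 + I : ℂ) / 2)⁻¹ = 1 - I := by
  rw [inv_div, div_eq_mul_inv, one_add_I_inv]; ring

lemma log_one_add_I_div_two :
    log ((1 + I) / 2) = -(Real.log 2 : ℂ) / 2 + Real.pi / 4 * I := by
  rw [log_div_two one_add_I_ne_zero, log_one_add_I]; ring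

lemma one_sub_I_ne_zero : (1 - I : ℂ) ≠ 0 := fun h => by simpa using congrArg re h

lemma log_one_sub_I_div_two :
    log ((1 - I) / 2) = -(Real.log 2 : ℂ) / 2 - Real.pi / 4 * I := by
  rw [log_div_two one_sub_I_ne_zero, log_one_sub_I]; ring

lemma one_add_I_div_two_mem_slitPlane : (1 + I : ℂ) / 2 ∈ slitPlane := Or.inl (by simp)

/-- For `z = (1 + I) / 2`, Landen's arguments `1 - z` and `1 - z⁻¹` are the conjugate of `z` and
`I`. Hence only the real part of `Li 3 z` is determined. -/
lemma Li_three_one_add_I_div_two :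
    Li 3 ((1 + I) / 2) + (starRingEnd ℂ) (Li 3 ((1 + I) / 2)) + Li 3 I = Li 3 1
      + (Real.log 2 : ℂ) ^ 3 / 24 - 5 / 96 * (Real.pi : ℂ) ^ 2 * Real.log 2
      + (Real.pi : ℂ) ^ 3 / 32 * I := by
  have h := trilog_landen norm_one_add_I_div_two_lt_one one_add_I_div_two_mem_slitPlane
  rw [inv_one_add_I_div_two, show (1 : ℂ) - (1 + I) / 2 = (1 - I) / 2 by ring,
    sub_sub_cancel, trilog_eq_Li_of_norm_lt_one norm_one_add_I_div_two_lt_one, trilog_eq_Li_of_norm_lt_one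
      (by rw [← conj_one_add_I_div _ (map_ofNat _ 2), norm_conj]; exact norm_one_add_I_div_two_lt_one),
    Li_one_sub_I_div_two, trilog_eq_Li (by simp) (fun h => by simpa using congrArg re h),
    log_one_add_I_div_two, log_one_sub_I_div_two] at h
  rw [h]
  ring_nf
  simp only [I_sq, I_pow_three]
  ring

/-- Spence–Kummer at `x = -1`, `y = 1 / 2`. Inversion sends the argument `-2` to `-1 / 2`,
duplication resolves `1 / 4`, and the resulting 18 copies of `Li 3 (1 / 2)` are known by Landen. -/
lemma Li_three_neg_eighth :
    Li 3 (-1 / 8) - 18 * Li 3 (-1 / 2) = 49 / 4 * Li 3 1 + 3 / 2 * (Real.log 2 : ℂ) ^ 3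
      - (Real.pi : ℂ) ^ 2 * Real.log 2 := by
  have h := trilog_spence_kummer (y := 1 / 2) (x₀ := -1) (Or.inl (by norm_num))
    (fun x hx => kummerAdmissible_half_neg_one hx) (by norm_num) (by norm_num)
  have hinv := trilog_inversion (x := 2) (Or.inl (by norm_num))
  rw [show -(2 : ℂ)⁻¹ = -1 / 2 by norm_num, log_two,
    trilog_eq_Li_of_norm_lt_one (z := -1 / 2) (by norm_num)] at hinv
  rw [show (-1 : ℂ) * (1 - 1 / 2) ^ 2 / (1 / 2 * (1 - -1) ^ 2) = -1 / 8 by norm_num,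
    show (-1 : ℂ) * (1 / 2) = -1 / 2 by norm_num,
    show (-1 : ℂ) / (1 / 2) = -2 by norm_num,
    show (-1 : ℂ) * (1 - 1 / 2) / (1 / 2 * (1 - -1)) = -1 / 2 by norm_num,
    show -((-1 : ℂ) * (1 - 1 / 2)) / (1 - -1) = 1 / 4 by norm_num,
    show ((1 : ℂ) - 1 / 2) / (1 - -1) = 1 / 4 by norm_num,
    show -((1 : ℂ) - 1 / 2) / (1 / 2 * (1 - -1)) = -1 / 2 by norm_num,
    show (1 : ℂ) - 1 / 2 = 1 / 2 by norm_num, show (1 : ℂ) - -1 = 2 by norm_num,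
    log_half, log_two, hinv,
    trilog_eq_Li_of_norm_lt_one (z := -1 / 2) (by norm_num),
    trilog_eq_Li_of_norm_lt_one (z := -1 / 8) (by norm_num),
    trilog_eq_Li_of_norm_lt_one (z := 1 / 4) (by norm_num),
    trilog_eq_Li_of_norm_lt_one (z := 1 / 2) (by norm_num),
    trilog_eq_Li (z := -1) (by simp) (by norm_num), Li_three_quarter, Li_three_neg_one] at h
  linear_combination h + 9 * Li_three_half

lemma neg_inv_one_sub_I : -((1 - I : ℂ)⁻¹) = -((1 + I) / 2) := by
  rw [← inv_one_add_I_div_two, inv_inv]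

/-- Spence–Kummer at `x = -1`, `y = (1 + I) / 2`. Only `x / y = -(1 - I)` leaves the unit disc, and
inversion sends it to `-((1 + I) / 2)`, as does `x * y`; duplication then introduces `I / 2`. -/
lemma Li_three_one_add_I_div_eight :
    Li 3 ((1 + I) / 8) - 7 / 2 * Li 3 (I / 2) - 4 * (starRingEnd ℂ) (Li 3 ((1 + I) / 4))
      - 4 * Li 3 ((1 + I) / 2) + 7 / 2 * Li 3 1
    = -5 / 16 * (Real.log 2 : ℂ) ^ 3 + 15 / 64 * (Real.pi : ℂ) ^ 2 * Real.log 2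
      + (7 / 32 * Real.pi * (Real.log 2 : ℂ) ^ 2 - 13 / 128 * (Real.pi : ℂ) ^ 3) * I := by
  have h := trilog_spence_kummer (y := (1 + I) / 2) (x₀ := -1) one_add_I_div_two_mem_slitPlane
    (fun x hx => kummerAdmissible_one_add_I_div_two_neg_one hx) norm_one_add_I_div_two_lt_one
    (by norm_num)
  have hinv := trilog_inversion (x := 1 - I) (Or.inl (by simp))
  have hk : ‖-((1 + I : ℂ) / 2)‖ < 1 := by rw [norm_neg]; exact norm_one_add_I_div_two_lt_one
  have hI := one_add_I_ne_zero
  have h4 : ‖(1 - I : ℂ) / 4‖ < 1 := by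
    rw [← conj_one_add_I_div _ (map_ofNat _ 4), norm_conj]
    simpa using norm_one_add_I_div_lt_one (r := 4) (by norm_num)
  rw [neg_inv_one_sub_I, log_one_sub_I, trilog_eq_Li_of_norm_lt_one hk] at hinv
  rw [show (-1 : ℂ) * (1 - (1 + I) / 2) ^ 2 / ((1 + I) / 2 * (1 - -1) ^ 2) = (1 + I) / 8 by
      rw [div_eq_iff (by norm_num [hI])]; linear_combination (-1 / 2 : ℂ) * I_sq,
    show (-1 : ℂ) * ((1 + I) / 2) = -((1 + I) / 2) by ring,
    show (-1 : ℂ) / ((1 + I) / 2) = -(1 - I) by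
      rw [← inv_one_add_I_div_two]; ring,
    show (-1 : ℂ) * (1 - (1 + I) / 2) / ((1 + I) / 2 * (1 - -1)) = I / 2 by
      rw [div_eq_iff (by norm_num [hI])]; linear_combination (-1 / 2 : ℂ) * I_sq,
    show -((-1 : ℂ) * (1 - (1 + I) / 2)) / (1 - -1) = (1 - I) / 4 by ring,
    show ((1 : ℂ) - (1 + I) / 2) / (1 - -1) = (1 - I) / 4 by ring,
    show -((1 : ℂ) - (1 + I) / 2) / ((1 + I) / 2 * (1 - -1)) = I / 2 by
      rw [div_eq_iff (by norm_num [hI])]; linear_combination (-1 / 2 : ℂ) * I_sq,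
    show (1 : ℂ) - (1 + I) / 2 = (1 - I) / 2 by ring, show (1 : ℂ) - -1 = 2 by norm_num,
    log_one_add_I_div_two, log_one_sub_I_div_two, log_two, hinv,
    trilog_eq_Li_of_norm_lt_one hk, trilog_eq_Li_of_norm_lt_one norm_one_add_I_div_two_lt_one,
    trilog_eq_Li_of_norm_lt_one (z := (1 + I) / 8)
      (by simpa using norm_one_add_I_div_lt_one (r := 8) (by norm_num)),
    trilog_eq_Li_of_norm_lt_one (z := I / 2) (by norm_num),
    trilog_eq_Li_of_norm_lt_one h4, Li_one_sub_I_div_four,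
    trilog_eq_Li (z := -1) (by simp) (by norm_num), Li_three_neg_one,
    Li_three_neg_one_add_I_div_two] at h
  have h2 : I ^ 2 = -1 := I_sq
  have h3 : I ^ 3 = -I := I_pow_three
  linear_combination h + 1 / 64 * (Real.pi : ℂ) ^ 2 * Real.log 2 * h2
    - 3 / 128 * (Real.pi : ℂ) ^ 3 * h3

/-- Spence–Kummer at `x = 1 - I`, `y = 1 / 2`. Three arguments leave the unit disc: `2 - 2 * I`,
`-(1 + I)` and `1 - I`, each brought back by an inversion. -/
lemma Li_three_one_add_I_div_four :
    Li 3 ((1 + I) / 4) - 9 / 4 * (starRingEnd ℂ) (Li 3 (I / 2))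
      + 2 * (starRingEnd ℂ) (Li 3 ((1 + I) / 2)) - 4 * Li 3 ((1 + I) / 2) - 2 * Li 3 I
      - 2 * Li 3 (1 / 2) + 2 * Li 3 1
    = -3 / 16 * (Real.log 2 : ℂ) ^ 3 + 9 / 64 * (Real.pi : ℂ) ^ 2 * Real.log 2
      + (3 / 32 * Real.pi * (Real.log 2 : ℂ) ^ 2 - 17 / 128 * (Real.pi : ℂ) ^ 3) * I := by
  have h := trilog_spence_kummer (y := 1 / 2) (x₀ := 1 - I) (Or.inl (by norm_num))
    (fun x hx => kummerAdmissible_half_one_sub_I hx) (by norm_num) one_sub_I_ne_zero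
  have hn2 : ‖(1 - I : ℂ) / 2‖ < 1 := by
    rw [← conj_one_add_I_div _ (map_ofNat _ 2), norm_conj]
    exact norm_one_add_I_div_two_lt_one
  have hnk : ‖-((1 - I : ℂ) / 2)‖ < 1 := by rwa [norm_neg]
  have inv1 := trilog_inversion (x := -2 + 2 * I) (Or.inr (by simp))
  have e1 : -(-2 + 2 * I : ℂ)⁻¹ = (1 + I) / 4 := by
    rw [show (-2 + 2 * I : ℂ) = -(4 * ((1 - I) / 2)) by ring, ← one_add_I_inv, inv_neg, mul_inv,
      inv_inv]
    ring
  rw [e1, log_neg_two_add_two_I, trilog_eq_Li_of_norm_lt_one (z := (1 + I) / 4)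
      (by simpa using norm_one_add_I_div_lt_one (r := 4) (by norm_num))] at inv1
  have inv2 := trilog_inversion (x := 1 + I) (Or.inl (by simp))
  rw [one_add_I_inv, log_one_add_I, trilog_eq_Li_of_norm_lt_one hnk] at inv2
  have inv3 := trilog_inversion (x := -1 + I) (Or.inr (by simp))
  have e3 : -(-1 + I : ℂ)⁻¹ = (1 + I) / 2 := by
    rw [show (-1 + I : ℂ) = -(1 - I) by ring, inv_neg, neg_inv_one_sub_I, neg_neg]
  rw [e3, log_neg_one_add_I,
    trilog_eq_Li_of_norm_lt_one norm_one_add_I_div_two_lt_one] at inv3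
  have hI := I_ne_zero
  rw [sub_sub_cancel,
    show (1 - I) * (1 - 1 / 2) ^ 2 / (1 / 2 * I ^ 2) = -((1 - I) / 2) by rw [I_sq]; ring,
    show (1 - I) * (1 / 2) = (1 - I) / 2 by ring,
    show (1 - I) / (1 / 2) = -(-2 + 2 * I) by ring,
    show (1 - I) * (1 - 1 / 2) / (1 / 2 * I) = -(1 + I) by
      rw [div_eq_iff (by norm_num)]; linear_combination (1 / 2 : ℂ) * I_sq,
    show -((1 - I) * (1 - 1 / 2)) / I = (1 + I) / 2 by
      rw [div_eq_iff (by norm_num)]; linear_combination (-1 / 2 : ℂ) * I_sq,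
    show ((1 : ℂ) - 1 / 2) / I = -I / 2 by
      rw [div_eq_iff (by norm_num)]; linear_combination (1 / 2 : ℂ) * I_sq,
    show -((1 : ℂ) - 1 / 2) / (1 / 2 * I) = I by
      rw [div_eq_iff (by norm_num)]; linear_combination (-1 / 2 : ℂ) * I_sq,
    -- Temporarily rewriting `1 - I` as a negative lets `inv3` match; the next line undoes this
    -- wherever `1 - I` stands for something else.
    show (1 - I : ℂ) = -(-1 + I) by ring, inv1, inv2, inv3,
    show -(-1 + I : ℂ) = (1 - I) by ring,
    show (1 : ℂ) - 1 / 2 = 1 / 2 by norm_num, log_half, log_I,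
    trilog_eq_Li_of_norm_lt_one hnk, trilog_eq_Li_of_norm_lt_one hn2,
    trilog_eq_Li_of_norm_lt_one norm_one_add_I_div_two_lt_one,
    trilog_eq_Li_of_norm_lt_one (z := -I / 2) (by norm_num),
    trilog_eq_Li_of_norm_lt_one (z := 1 / 2) (by norm_num),
    trilog_eq_Li (by simp) (fun h => by simpa using congrArg re h),
    Li_neg_I_div_two, Li_one_sub_I_div_two, Li_neg_one_sub_I_div_two,
    Li_three_neg_one_add_I_div_two] at h
  simp only [map_sub, map_div₀, map_ofNat] at h
  have h2 : I ^ 2 = -1 := I_sq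
  have h3 : I ^ 3 = -I := I_pow_three
  linear_combination h + 7 / 64 * (Real.pi : ℂ) ^ 2 * Real.log 2 * h2
    - 29 / 384 * (Real.pi : ℂ) ^ 3 * h3

/-! ### Trilogarithms as series over residue classes modulo 8 -/

lemma summable_S_term {n : ℕ} (hn : 2 ≤ n) (p : ℕ) (a : Fin 8 → ℤ) :
    Summable fun j : ℕ => (a ⟨j % 8, Nat.mod_lt j (by norm_num)⟩ : ℝ) /
      (2 ^ ((p * (j + 1) + p) / 2) * ((j : ℝ) + 1) ^ n) := by
  refine Summable.of_norm_bounded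
    ((summable_one_div_succ_pow hn).mul_left (∑ i, |(a i : ℝ)|)) fun j => ?_
  rw [norm_div, Real.norm_eq_abs, Real.norm_of_nonneg (by positivity), ← mul_div_assoc, mul_one]
  refine div_le_div₀ (by positivity) ?_ (by positivity) ?_
  · exact Finset.single_le_sum (f := fun i => |(a i : ℝ)|) (fun i _ => abs_nonneg _)
      (Finset.mem_univ _)
  · exact le_mul_of_one_le_left (by positivity) (one_le_pow₀ (by norm_num))

lemma S_eq_sum {n : ℕ} (hn : 2 ≤ n) (p : ℕ) (a : Fin 8 → ℤ) :
    S n p a = ∑ i, (a i : ℝ) * S n p (Pi.single i 1) := by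
  simp only [S, ← tsum_mul_left]
  rw [← Summable.tsum_finsetSum fun i _ => (summable_S_term hn p (Pi.single i 1)).mul_left _]
  refine tsum_congr fun j => ?_
  rw [Finset.sum_eq_single ⟨j % 8, Nat.mod_lt j (by norm_num)⟩]
  · simp [div_eq_mul_inv]
  · intro i _ hi
    simp [hi.symm]
  · simp

lemma pow_mul_two_pow_add {z : ℂ} {d e : ℕ} (h : z ^ d * 2 ^ e = 1) (q s t : ℕ) :
    z ^ (d * q + s) * 2 ^ (e * q + t) = z ^ s * 2 ^ t := by
  rw [pow_add, pow_add, pow_mul, pow_mul, mul_mul_mul_comm, ← mul_pow, h, one_pow, one_mul]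

/-- For `z` of modulus `2^(-p/2)` with argument an odd multiple of `π/4`, and `p` odd, the exponent
in `S` absorbs the decay of `z ^ k`, leaving `c = 2^((p-1)/2)` times a Gaussian integer of period 8
in `k`. -/
lemma Li_eq_S {n p : ℕ} (hn : 2 ≤ n) {z : ℂ} {c : ℝ} {a b : Fin 8 → ℤ}
    (h8 : z ^ 8 * 2 ^ (4 * p) = 1)
    (hr : ∀ r : Fin 8, z ^ ((r : ℕ) + 1) * 2 ^ ((p * ((r : ℕ) + 1) + p) / 2)
      = c * (a r + b r * I)) :
    Li n z = c * S n p a + c * S n p b * I := by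
  have key : ∀ j : ℕ, z ^ (j + 1) / ((j : ℂ) + 1) ^ n
      = c * (((a ⟨j % 8, Nat.mod_lt j (by norm_num)⟩ : ℝ) /
          (2 ^ ((p * (j + 1) + p) / 2) * ((j : ℝ) + 1) ^ n) : ℝ) : ℂ)
        + c * (((b ⟨j % 8, Nat.mod_lt j (by norm_num)⟩ : ℝ) /
          (2 ^ ((p * (j + 1) + p) / 2) * ((j : ℝ) + 1) ^ n) : ℝ) : ℂ) * I := by
    intro j
    have hj : (j : ℂ) + 1 ≠ 0 := Nat.cast_add_one_ne_zero j
    have h := hr ⟨j % 8, Nat.mod_lt j (by norm_num)⟩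
    have hpow : z ^ (j + 1) * 2 ^ ((p * (j + 1) + p) / 2)
        = z ^ (j % 8 + 1) * 2 ^ ((p * (j % 8 + 1) + p) / 2) := by
      obtain ⟨q, r, rfl, hr8⟩ : ∃ q r, j = 8 * q + r ∧ j % 8 = r :=
        ⟨j / 8, j % 8, (Nat.div_add_mod j 8).symm, rfl⟩
      rw [hr8]
      have e : (p * (8 * q + r + 1) + p) / 2 = 4 * p * q + (p * (r + 1) + p) / 2 := by
        rw [show p * (8 * q + r + 1) + p = p * (r + 1) + p + 2 * (4 * p * q) by ring,
          Nat.add_mul_div_left _ _ two_pos, add_comm]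
      rw [e, add_assoc]
      exact pow_mul_two_pow_add h8 q _ _
    have h2 : (2 : ℂ) ^ ((p * (j + 1) + p) / 2) ≠ 0 := pow_ne_zero _ two_ne_zero
    simp only at h
    rw [← hpow] at h
    rw [eq_div_of_mul_eq h2 h]
    push_cast
    field_simp
  have sa := ((hasSum_ofReal).2 (summable_S_term hn p a).hasSum).mul_left (c : ℂ)
  have sb := (((hasSum_ofReal).2 (summable_S_term hn p b).hasSum).mul_left (c : ℂ)).mul_right I
  exact (tsum_congr key).trans (sa.add sb).tsum_eq

lemma S_eq_tsum_odd {n : ℕ} (hn : 2 ≤ n) (p : ℕ) {a : Fin 8 → ℤ}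
    (ha : ∀ r : Fin 8, (r : ℕ) % 2 = 0 → a r = 0) :
    HasSum (fun m : ℕ => (a ⟨(2 * m + 1) % 8, Nat.mod_lt _ (by norm_num)⟩ : ℝ) /
      (2 ^ ((p * (2 * m + 1 + 1) + p) / 2) * (((2 * m + 1 : ℕ) : ℝ) + 1) ^ n)) (S n p a) := by
  set f : ℕ → ℝ := fun j => (a ⟨j % 8, Nat.mod_lt j (by norm_num)⟩ : ℝ) /
      (2 ^ ((p * (j + 1) + p) / 2) * ((j : ℝ) + 1) ^ n) with hf
  have hs : Summable f := summable_S_term hn p a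
  have hinj2 : Function.Injective fun k : ℕ => 2 * k := fun a b h => by simpa using h
  have hinj3 : Function.Injective fun k : ℕ => 2 * k + 1 := fun a b h => by simpa using h
  have hodd : Summable fun k => f (2 * k + 1) := hs.comp_injective hinj3
  have hsplit : ∑' k, f (2 * k) + ∑' k, f (2 * k + 1) = ∑' k, f k :=
    tsum_even_add_odd (hs.comp_injective hinj2) hodd
  have heven : ∀ k : ℕ, f (2 * k) = 0 := fun k => by
    simp only [hf]
    rw [ha _ (by simp only; omega)]
    simp
  rw [tsum_congr heven, tsum_zero, zero_add] at hsplit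
  have hS : S n p a = ∑' k, f k := rfl
  rw [hS, ← hsplit]
  exact hodd.hasSum

/-- For the points of modulus `2^(-p)` on the axes, the `m`-th term is placed at the even index `k =
2 * m`; replacing `m ^ n` by `k ^ n` costs the factor `2 ^ n`. Even `k` are odd positions in the
zero-based coefficient vectors. -/
lemma Li_eq_S_of_even {n p : ℕ} (hn : 2 ≤ n) {z : ℂ} {c : ℝ} {a b : Fin 8 → ℤ}
    (ha : ∀ r : Fin 8, (r : ℕ) % 2 = 0 → a r = 0) (hb : ∀ r : Fin 8, (r : ℕ) % 2 = 0 → b r = 0)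
    (h4 : z ^ 4 * 2 ^ (4 * p) = 1)
    (hr : ∀ r : Fin 4, z ^ ((r : ℕ) + 1) * 2 ^ ((p * (2 * (r : ℕ) + 2) + p) / 2)
      = c * (a ⟨2 * r + 1, by omega⟩ + b ⟨2 * r + 1, by omega⟩ * I)) :
    Li n z = 2 ^ n * c * S n p a + 2 ^ n * c * S n p b * I := by
  have key : ∀ m : ℕ, z ^ (m + 1) / ((m : ℂ) + 1) ^ n
      = 2 ^ n * c * (((a ⟨(2 * m + 1) % 8, Nat.mod_lt _ (by norm_num)⟩ : ℝ) /
      (2 ^ ((p * (2 * m + 1 + 1) + p) / 2) * (((2 * m + 1 : ℕ) : ℝ) + 1) ^ n) : ℝ) : ℂ)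
        + 2 ^ n * c * (((b ⟨(2 * m + 1) % 8, Nat.mod_lt _ (by norm_num)⟩ : ℝ) /
      (2 ^ ((p * (2 * m + 1 + 1) + p) / 2) * (((2 * m + 1 : ℕ) : ℝ) + 1) ^ n) : ℝ) : ℂ) * I := by
    intro j
    have hj : (j : ℂ) + 1 ≠ 0 := Nat.cast_add_one_ne_zero j
    have hmod : (2 * j + 1) % 8 = 2 * (j % 4) + 1 := by omega
    have h := hr ⟨j % 4, Nat.mod_lt j (by norm_num)⟩
    have hpow : z ^ (j + 1) * 2 ^ ((p * (2 * j + 1 + 1) + p) / 2)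
        = z ^ (j % 4 + 1) * 2 ^ ((p * (2 * (j % 4) + 2) + p) / 2) := by
      obtain ⟨q, r, rfl, hr8⟩ : ∃ q r, j = 4 * q + r ∧ j % 4 = r :=
        ⟨j / 4, j % 4, (Nat.div_add_mod j 4).symm, rfl⟩
      rw [hr8]
      have e : (p * (2 * (4 * q + r) + 1 + 1) + p) / 2
          = 4 * p * q + (p * (2 * r + 2) + p) / 2 := by
        rw [show p * (2 * (4 * q + r) + 1 + 1) + p = p * (2 * r + 2) + p + 2 * (4 * p * q) by ring,
          Nat.add_mul_div_left _ _ two_pos, add_comm]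
      rw [e, add_assoc]
      exact pow_mul_two_pow_add h4 q _ _
    have h2 : (2 : ℂ) ^ ((p * (2 * j + 1 + 1) + p) / 2) ≠ 0 := pow_ne_zero _ two_ne_zero
    simp only at h
    rw [← hpow] at h
    rw [eq_div_of_mul_eq h2 h]
    simp only [hmod]
    have hcast : (((2 * j + 1 : ℕ) : ℂ) + 1) = 2 * ((j : ℂ) + 1) := by push_cast; ring
    simp only [ofReal_div, ofReal_mul, ofReal_pow, ofReal_add, ofReal_natCast, ofReal_intCast,
      ofReal_one, ofReal_ofNat, hcast, mul_pow]
    field_simp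
  have sa := ((hasSum_ofReal).2 (S_eq_tsum_odd hn p ha)).mul_left (2 ^ n * c : ℂ)
  have sb := (((hasSum_ofReal).2 (S_eq_tsum_odd hn p hb)).mul_left
    (2 ^ n * c : ℂ)).mul_right I
  exact (tsum_congr key).trans (sa.add sb).tsum_eq

lemma Li_three_one_add_I_div_two_eq_S : Li 3 ((1 + I) / 2)
    = (1 : ℝ) * S 3 1 ![1, 0, -1, -1, -1, 0, 1, 1]
      + (1 : ℝ) * S 3 1 ![1, 1, 1, 0, -1, -1, -1, 0] * I := by
  have h2 : ((1 + I) / 2) ^ 2 = I / 2 := by linear_combination I_sq / 4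
  refine Li_eq_S (by norm_num) ?_ fun r => ?_
  · rw [show ((1 + I) / 2) ^ 8 = (((1 + I) / 2) ^ 2) ^ 4 by ring, h2, div_pow, I_pow_four]
    norm_num
  · fin_cases r <;> simp [pow_succ] <;> ring_nf <;> simp [I_sq, I_pow_three] <;> ring_nf

lemma Li_three_one_add_I_div_four_eq_S : Li 3 ((1 + I) / 4)
    = (2 : ℝ) * S 3 3 ![1, 0, -1, -1, -1, 0, 1, 1]
      + (2 : ℝ) * S 3 3 ![1, 1, 1, 0, -1, -1, -1, 0] * I := by
  have h2 : ((1 + I) / 4) ^ 2 = I / 8 := by linear_combination I_sq / 16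
  refine Li_eq_S (by norm_num) ?_ fun r => ?_
  · rw [show ((1 + I) / 4) ^ 8 = (((1 + I) / 4) ^ 2) ^ 4 by ring, h2, div_pow, I_pow_four]
    norm_num
  · fin_cases r <;> simp [pow_succ] <;> ring_nf <;> simp [I_sq, I_pow_three] <;> ring_nf

lemma Li_three_one_add_I_div_eight_eq_S : Li 3 ((1 + I) / 8)
    = (4 : ℝ) * S 3 5 ![1, 0, -1, -1, -1, 0, 1, 1]
      + (4 : ℝ) * S 3 5 ![1, 1, 1, 0, -1, -1, -1, 0] * I := by
  have h2 : ((1 + I) / 8) ^ 2 = I / 32 := by linear_combination I_sq / 64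
  refine Li_eq_S (by norm_num) ?_ fun r => ?_
  · rw [show ((1 + I) / 8) ^ 8 = (((1 + I) / 8) ^ 2) ^ 4 by ring, h2, div_pow, I_pow_four]
    norm_num
  · fin_cases r <;> simp [pow_succ] <;> ring_nf <;> simp [I_sq, I_pow_three] <;> ring_nf

lemma Li_three_half_eq_S : Li 3 (1 / 2)
    = 2 ^ 3 * (1 : ℝ) * S 3 1 ![0, 1, 0, 1, 0, 1, 0, 1]
      + 2 ^ 3 * (1 : ℝ) * S 3 1 ![0, 0, 0, 0, 0, 0, 0, 0] * I := by
  refine Li_eq_S_of_even (by norm_num) (by decide) (by decide) ?_ fun r => ?_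
  · norm_num [div_pow]
  · fin_cases r <;> norm_num [pow_succ]

lemma Li_three_neg_half_eq_S : Li 3 (-1 / 2)
    = 2 ^ 3 * (1 : ℝ) * S 3 1 ![0, -1, 0, 1, 0, -1, 0, 1]
      + 2 ^ 3 * (1 : ℝ) * S 3 1 ![0, 0, 0, 0, 0, 0, 0, 0] * I := by
  refine Li_eq_S_of_even (by norm_num) (by decide) (by decide) ?_ fun r => ?_
  · norm_num [div_pow]
  · fin_cases r <;> norm_num [pow_succ]

lemma Li_three_neg_eighth_eq_S : Li 3 (-1 / 8)
    = 2 ^ 3 * (2 : ℝ) * S 3 3 ![0, -1, 0, 1, 0, -1, 0, 1]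
      + 2 ^ 3 * (2 : ℝ) * S 3 3 ![0, 0, 0, 0, 0, 0, 0, 0] * I := by
  refine Li_eq_S_of_even (by norm_num) (by decide) (by decide) ?_ fun r => ?_
  · norm_num [div_pow]
  · fin_cases r <;> norm_num [pow_succ]

lemma Li_three_I_div_two_eq_S : Li 3 (I / 2)
    = 2 ^ 3 * (1 : ℝ) * S 3 1 ![0, 0, 0, -1, 0, 0, 0, 1]
      + 2 ^ 3 * (1 : ℝ) * S 3 1 ![0, 1, 0, 0, 0, -1, 0, 0] * I := by
  refine Li_eq_S_of_even (by norm_num) (by decide) (by decide) ?_ fun r => ?_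
  · norm_num [div_pow]
  · fin_cases r <;> norm_num [pow_succ] <;> ring_nf <;> norm_num [I_sq, I_pow_three]

/-! ### The constants of the ladders -/

/-- The odd part of the polylogarithm produces the series of `lam` at `z = 1` and that of `beta` at
`z = I`. -/
lemma hasSum_Li_sub_Li_neg {n : ℕ} (hn : 2 ≤ n) {z : ℂ} (hz : ‖z‖ ≤ 1) :
    HasSum (fun k : ℕ => 2 * (z ^ (2 * k + 1) / (2 * (k : ℂ) + 1) ^ n)) (Li n z - Li n (-z)) := by
  have hs := summable_Li hn hz
  have hs' := summable_Li hn (z := -z) (by simpa using hz)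
  set f : ℕ → ℂ := fun k => z ^ (k + 1) / ((k : ℂ) + 1) ^ n - (-z) ^ (k + 1) / ((k : ℂ) + 1) ^ n
    with hf
  have hsub : Summable f := hs.sub hs'
  have hinj2 : Function.Injective fun k : ℕ => 2 * k := fun a b h => by simpa using h
  have hinj3 : Function.Injective fun k : ℕ => 2 * k + 1 := fun a b h => by simpa using h
  have heven : Summable fun k => f (2 * k) := hsub.comp_injective hinj2
  have hsum : Li n z - Li n (-z) = ∑' k, f k := (hs.tsum_sub hs').symm
  have hsplit : ∑' k, f (2 * k) + ∑' k, f (2 * k + 1) = ∑' k, f k :=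
    tsum_even_add_odd heven (hsub.comp_injective hinj3)
  have hodd : ∀ k : ℕ, f (2 * k + 1) = 0 := by
    intro k
    simp only [hf]
    rw [Even.neg_pow ⟨k + 1, by ring⟩, sub_self]
  rw [tsum_congr hodd, tsum_zero, add_zero] at hsplit
  rw [hsum, ← hsplit]
  refine heven.hasSum.congr_fun ?_
  intro k
  simp only [hf]
  rw [Odd.neg_pow ⟨k, rfl⟩]
  push_cast
  ring

lemma Li_three_one_eq : Li 3 1 = ((8 / 7 * lam 3 : ℝ) : ℂ) := by
  have h := hasSum_Li_sub_Li_neg (n := 3) (by norm_num) (z := 1) (by simp)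
  have h2 : HasSum (fun k : ℕ => ((2 * (1 / (2 * (k : ℝ) + 1) ^ 3) : ℝ) : ℂ))
      (Li 3 1 - Li 3 (-1)) := by
    refine h.congr_fun fun k => ?_
    push_cast
    simp
  have h3 : Li 3 1 - Li 3 (-1) = ((2 * lam 3 : ℝ) : ℂ) := by
    rw [lam, ← tsum_mul_left, ofReal_tsum]
    exact h2.tsum_eq.symm
  rw [Li_three_neg_one] at h3
  push_cast at h3 ⊢
  linear_combination 4 / 7 * h3

lemma lam_three_eq : (lam 3 : ℂ) = 7 / 8 * riemannZeta 3 := by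
  have h := Li_at_one (n := 3) (by norm_num)
  rw [Li_three_one_eq] at h
  push_cast at h
  rw [← h]
  ring

lemma beta_three : beta 3 = Real.pi ^ 3 / 32 := by
  have h := hasSum_Li_sub_Li_neg (n := 3) (by norm_num) (z := I) (by simp)
  rw [Li_neg_I, Li_three_I_sub_conj] at h
  have h2 := hasSum_im h
  have h3 : HasSum (fun k : ℕ => (-1 : ℝ) ^ k / (2 * (k : ℝ) + 1) ^ 3) (Real.pi ^ 3 / 32) := by
    convert! h2.mul_left (1 / 2) using 1
    · ext k
      have e : (2 : ℂ) * (I ^ (2 * k + 1) / (2 * (k : ℂ) + 1) ^ 3)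
          = ((2 * ((-1 : ℝ) ^ k / (2 * (k : ℝ) + 1) ^ 3) : ℝ) : ℂ) * I := by
        rw [pow_succ, pow_mul, I_sq]
        push_cast
        ring
      rw [e, mul_I_im, ofReal_re]
      ring
    · have e : (Real.pi : ℂ) ^ 3 / 16 * I = ((Real.pi ^ 3 / 16 : ℝ) : ℂ) * I := by push_cast; ring
      rw [e, mul_I_im, ofReal_re]
      ring
  -- For exponent 3 the series converges absolutely, so the limit of partial sums is the
  -- unconditional sum.
  rw [beta, tsum_eq_of_summable_unconditional h3.summable]
  exact h3.tsum_eq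

lemma beta_one : beta 1 = Real.pi / 4 := by
  have h : HasSum (fun k : ℕ => (-1 : ℝ) ^ k / (2 * (k : ℝ) + 1) ^ 1) (Real.pi / 4)
      (SummationFilter.conditional ℕ) := by
    rw [HasSum, SummationFilter.conditional_filter_eq_map_range, tendsto_map'_iff]
    simp only [pow_one]
    exact Real.tendsto_sum_pi_div_four
  exact h.tsum_eq

lemma zetaTwo_eq : zetaTwo = Real.pi ^ 2 / 6 := by
  have : riemannZeta 2 = ((Real.pi ^ 2 / 6 : ℝ) : ℂ) := by
    rw [riemannZeta_two]; push_cast; rfl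
  rw [zetaTwo, this, ofReal_re]

lemma L_three : L 3 = -Real.log 2 ^ 3 / 6 := by
  norm_num [L, show Int.toNat 3 = 3 from rfl, Nat.factorial]; ring

lemma L_two : L 2 = Real.log 2 ^ 2 / 2 := by
  norm_num [L, show Int.toNat 2 = 2 from rfl, Nat.factorial]

lemma L_one : L 1 = -Real.log 2 := by
  norm_num [L, Nat.factorial]

/-! ### Real and imaginary parts of the relations -/

lemma Li_three_I_re : (Li 3 I).re = -3 / 28 * lam 3 := by
  have h := congrArg re Li_three_I_add_conj
  rw [Li_three_one_eq, show (-3 / 16 : ℂ) * ((8 / 7 * lam 3 : ℝ) : ℂ)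
    = ((-3 / 14 * lam 3 : ℝ) : ℂ) by push_cast; ring, ofReal_re, add_re, conj_re] at h
  linarith

lemma Li_three_I_im : (Li 3 I).im = Real.pi ^ 3 / 32 := by
  have h := congrArg im Li_three_I_sub_conj
  rw [show (Real.pi : ℂ) ^ 3 / 16 * I = ((Real.pi ^ 3 / 16 : ℝ) : ℂ) * I by push_cast; ring,
    mul_I_im, ofReal_re, sub_im, conj_im] at h
  linarith

lemma Li_three_half_eq_ofReal : Li 3 (1 / 2)
    = ((lam 3 + Real.log 2 ^ 3 / 6 - Real.pi ^ 2 * Real.log 2 / 12 : ℝ) : ℂ) := by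
  have := Li_three_half
  rw [Li_three_one_eq] at this
  push_cast at this ⊢
  linear_combination this / 2

lemma Li_three_half_re :
    (Li 3 (1 / 2)).re = lam 3 + Real.log 2 ^ 3 / 6 - Real.pi ^ 2 * Real.log 2 / 12 := by
  rw [Li_three_half_eq_ofReal, ofReal_re]

lemma Li_three_half_im : (Li 3 (1 / 2)).im = 0 := by
  rw [Li_three_half_eq_ofReal, ofReal_im]

lemma Li_three_one_add_I_div_two_re :
    (Li 3 ((1 + I) / 2)).re = 5 / 8 * lam 3 + Real.log 2 ^ 3 / 48
      - 5 / 192 * Real.pi ^ 2 * Real.log 2 := by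
  have h := congrArg re Li_three_one_add_I_div_two
  rw [Li_three_one_eq, show ((8 / 7 * lam 3 : ℝ) : ℂ) + (Real.log 2 : ℂ) ^ 3 / 24
      - 5 / 96 * (Real.pi : ℂ) ^ 2 * Real.log 2 + (Real.pi : ℂ) ^ 3 / 32 * I
      = ((8 / 7 * lam 3 + Real.log 2 ^ 3 / 24 - 5 / 96 * Real.pi ^ 2 * Real.log 2 : ℝ) : ℂ)
        + ((Real.pi ^ 3 / 32 : ℝ) : ℂ) * I by push_cast; ring] at h
  simp only [add_re, conj_re, ofReal_re, re_ofReal_mul, I_re, mul_zero, Li_three_I_re] at h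
  linarith

lemma Li_three_neg_eighth_re :
    (Li 3 (-1 / 8)).re - 18 * (Li 3 (-1 / 2)).re = 14 * lam 3 + 3 / 2 * Real.log 2 ^ 3
      - Real.pi ^ 2 * Real.log 2 := by
  have h := congrArg re Li_three_neg_eighth
  rw [Li_three_one_eq, show (49 / 4 : ℂ) * ((8 / 7 * lam 3 : ℝ) : ℂ)
      + 3 / 2 * (Real.log 2 : ℂ) ^ 3 - (Real.pi : ℂ) ^ 2 * Real.log 2
      = ((14 * lam 3 + 3 / 2 * Real.log 2 ^ 3 - Real.pi ^ 2 * Real.log 2 : ℝ) : ℂ) by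
        push_cast; ring, ofReal_re, show (18 : ℂ) = ((18 : ℝ) : ℂ) by push_cast; rfl,
        sub_re, re_ofReal_mul] at h
  exact h

lemma Li_three_one_add_I_div_four_re_im :
    (Li 3 ((1 + I) / 4)).re - 9 / 4 * (Li 3 (I / 2)).re
      = 3 / 4 * lam 3 + 3 / 16 * Real.log 2 ^ 3 - 5 / 64 * Real.pi ^ 2 * Real.log 2 ∧
    (Li 3 ((1 + I) / 4)).im + 9 / 4 * (Li 3 (I / 2)).im - 6 * (Li 3 ((1 + I) / 2)).im
      = 3 / 32 * Real.pi * Real.log 2 ^ 2 - 9 / 128 * Real.pi ^ 3 := by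
  have h := Li_three_one_add_I_div_four
  have hw := Li_three_one_add_I_div_two_re
  have ht := Li_three_I_re
  have ht' := Li_three_I_im
  have ha := Li_three_half_re
  have ha' := Li_three_half_im
  rw [Li_three_one_eq] at h
  -- The special values and `log 2` become opaque, so that `simp` only separates real and imaginary
  -- parts.
  generalize Li 3 ((1 + I) / 4) = u at *
  generalize Li 3 ((1 + I) / 2) = w at *
  generalize Li 3 (I / 2) = j at *
  generalize Li 3 I = t at *
  generalize Li 3 (1 / 2) = a at *
  generalize Real.log 2 = l at *
  have hre := congrArg re h
  have him := congrArg im h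
  simp [← ofReal_pow, -ofReal_mul] at hre him
  constructor <;> linarith

lemma Li_three_one_add_I_div_eight_re_im :
    (Li 3 ((1 + I) / 8)).re - 7 / 2 * (Li 3 (I / 2)).re - 4 * (Li 3 ((1 + I) / 4)).re
      = -3 / 2 * lam 3 - 11 / 48 * Real.log 2 ^ 3 + 25 / 192 * Real.pi ^ 2 * Real.log 2 ∧
    (Li 3 ((1 + I) / 8)).im - 7 / 2 * (Li 3 (I / 2)).im + 4 * (Li 3 ((1 + I) / 4)).im
        - 4 * (Li 3 ((1 + I) / 2)).im
      = 7 / 32 * Real.pi * Real.log 2 ^ 2 - 13 / 128 * Real.pi ^ 3 := by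
  have h := Li_three_one_add_I_div_eight
  have hw := Li_three_one_add_I_div_two_re
  rw [Li_three_one_eq] at h
  generalize Li 3 ((1 + I) / 8) = v at *
  generalize Li 3 ((1 + I) / 4) = u at *
  generalize Li 3 ((1 + I) / 2) = w at *
  generalize Li 3 (I / 2) = j at *
  generalize Real.log 2 = l at *
  have hre := congrArg re h
  have him := congrArg im h
  simp [← ofReal_pow, -ofReal_mul] at hre him
  constructor <;> linarith

/-! ### The ladders -/

lemma A_three : A 3 = (Li 3 (1 / 2)).re := rfl

lemma B_three : B 3 = 4 * (Li 3 ((1 + I) / 2)).re := by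
  rw [B, show (2 : ℂ) ^ (((3 : ℕ) : ℤ) - 1) = ((4 : ℝ) : ℂ) by norm_num, re_ofReal_mul]

lemma F_three : F 3 = 4 * (Li 3 ((1 + I) / 2)).im := by
  rw [F, show (2 : ℂ) ^ (((3 : ℕ) : ℤ) - 1) = ((4 : ℝ) : ℂ) by norm_num, im_ofReal_mul]

lemma two_thirds_zpow : (2 / 3 : ℂ) ^ (((3 : ℕ) : ℤ) - 1) = ((4 / 9 : ℝ) : ℂ) := by
  norm_num

lemma two_fifths_zpow : (2 / 5 : ℂ) ^ (((3 : ℕ) : ℤ) - 1) = ((4 / 25 : ℝ) : ℂ) := by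
  norm_num

lemma D_three : D 3 = 4 / 9 * (Li 3 ((1 + I) / 4)).re - (Li 3 (I / 2)).re := by
  rw [D, two_thirds_zpow, sub_re, re_ofReal_mul, Li_neg_I_div_two, conj_re]

lemma G_three : G 3 = 4 / 9 * (Li 3 ((1 + I) / 4)).im + (Li 3 (I / 2)).im := by
  rw [G, two_thirds_zpow, sub_im, im_ofReal_mul, Li_neg_I_div_two, conj_im, sub_neg_eq_add]

lemma E_three : E 3 = 4 / 25 * (Li 3 ((1 + I) / 8)).re - 2 * (Li 3 (I / 2)).re := by
  rw [E, two_fifths_zpow, show (2 : ℂ) * Li 3 (-I / 2) = ((2 : ℝ) : ℂ) * Li 3 (-I / 2) by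
    push_cast; rfl, sub_re, re_ofReal_mul, re_ofReal_mul, Li_neg_I_div_two,
    Li_one_sub_I_div_eight, conj_re, conj_re]

lemma H_three : H 3 = -(4 / 25 * (Li 3 ((1 + I) / 8)).im) + 2 * (Li 3 (I / 2)).im := by
  rw [H, two_fifths_zpow, show (2 : ℂ) * Li 3 (-I / 2) = ((2 : ℝ) : ℂ) * Li 3 (-I / 2) by
    push_cast; rfl, sub_im, im_ofReal_mul, im_ofReal_mul, Li_neg_I_div_two,
    Li_one_sub_I_div_eight, conj_im, conj_im]
  ring

/-- On the imaginary axis negation is conjugation, so duplication produces twice the real part. -/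
lemma Li_three_re_of_imaginary {y : ℝ} (hy : |y| ≤ 1) :
    (Li 3 (y * I)).re = (Li 3 ((-y ^ 2 : ℝ) : ℂ)).re / 8 := by
  have h := Li_sq (n := 3) (z := y * I) (by norm_num) (by simpa using hy)
  rw [show ((y : ℂ) * I) ^ 2 = ((-y ^ 2 : ℝ) : ℂ) by
      push_cast; linear_combination (y : ℂ) ^ 2 * I_sq,
    show -((y : ℂ) * I) = (starRingEnd ℂ) (y * I) by simp, Li_conj] at h
  generalize Li 3 ((-y ^ 2 : ℝ) : ℂ) = q at *
  have hre := congrArg re h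
  norm_num at hre
  linarith

lemma C_three : C 3 = (Li 3 (-1 / 8)).re / 18 - (Li 3 (-1 / 2)).re := by
  have h8 : (0 : ℝ) < √8 := by positivity
  have h2 : (0 : ℝ) < √2 := by positivity
  have e8 : I / ((√8 : ℝ) : ℂ) = (((√8)⁻¹ : ℝ) : ℂ) * I := by
    push_cast; rw [div_eq_mul_inv, mul_comm]
  have e2 : -I / ((√2 : ℝ) : ℂ) = ((-(√2)⁻¹ : ℝ) : ℂ) * I := by
    push_cast; rw [div_eq_mul_inv]; ring
  have l8 : |(√8)⁻¹| ≤ 1 := by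
    rw [abs_of_pos (by positivity)]
    exact inv_le_one_of_one_le₀ (Real.one_le_sqrt.2 (by norm_num))
  have l2 : |(-(√2)⁻¹)| ≤ 1 := by
    rw [abs_neg, abs_of_pos (by positivity)]
    exact inv_le_one_of_one_le₀ (Real.one_le_sqrt.2 (by norm_num))
  have s8 : ((-((√8)⁻¹) ^ 2 : ℝ) : ℂ) = -1 / 8 := by
    rw [inv_pow, Real.sq_sqrt (by norm_num)]; norm_num
  have s2 : ((-(-(√2)⁻¹) ^ 2 : ℝ) : ℂ) = -1 / 2 := by
    rw [neg_sq, inv_pow, Real.sq_sqrt (by norm_num)]; norm_num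
  have r8 := Li_three_re_of_imaginary l8
  have r2 := Li_three_re_of_imaginary l2
  rw [s8, ← e8] at r8
  rw [s2, ← e2] at r2
  rw [C, two_thirds_zpow, show (2 : ℂ) ^ 3 = ((8 : ℝ) : ℂ) by norm_num, sub_re, re_ofReal_mul,
    re_ofReal_mul, r8, r2]
  ring

lemma real_ladders : lam 3 = Abar 3 ∧ lam 3 = 2 / 5 * Bbar 3 ∧ lam 3 = 9 / 7 * Cbar 3 ∧
    lam 3 = 3 * Dbar 3 ∧ lam 3 = 25 / 6 * Ebar 3 := by
  have e1 : ((3 : ℤ) - 2) = 1 := rfl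
  have e3 : ((3 : ℕ) : ℤ) = 3 := rfl
  have a := Li_three_half_re
  have b := Li_three_one_add_I_div_two_re
  have c := Li_three_neg_eighth_re
  have d := Li_three_one_add_I_div_four_re_im.1
  have e := Li_three_one_add_I_div_eight_re_im.1
  simp only [Abar, Bbar, Cbar, Dbar, Ebar, e1, e3, A_three, B_three, C_three, D_three, E_three,
    L_three, L_one, zetaTwo_eq]
  -- The first four use `a`, `b`, `c`, `d` respectively. The last uses `e + 4 * d`, which cancels
  -- the value at `(1 + I) / 4`.
  refine ⟨?_, ?_, ?_, ?_, ?_⟩ <;> linarith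

lemma imaginary_ladders : beta 3 = 2 / 3 * Fbar 3 - Gbar 3 ∧
    beta 3 = 20 / 23 * Fbar 3 - 25 / 23 * Hbar 3 := by
  have e2 : (((3 : ℕ) : ℤ) - 1) = 2 := rfl
  have d := Li_three_one_add_I_div_four_re_im.2
  have e := Li_three_one_add_I_div_eight_re_im.2
  simp only [Fbar, Gbar, Hbar, e2, F_three, G_three, H_three, L_two, beta_one, beta_three]
  -- The first uses `d`; the second uses `e - 4 * d`, again free of the value at `(1 + I) / 4`.
  constructor <;> linarith

/-! ### The three series -/

/-- The part of the series `S` with all coefficients one over a residue class modulo `8`. -/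
def residueSum (n p : ℕ) (i : Fin 8) : ℝ := S n p (Pi.single i 1)

lemma S_eq_residueSum {n : ℕ} (hn : 2 ≤ n) (p : ℕ) (a₀ a₁ a₂ a₃ a₄ a₅ a₆ a₇ : ℤ) :
    S n p ![a₀, a₁, a₂, a₃, a₄, a₅, a₆, a₇] = a₀ * residueSum n p 0 + a₁ * residueSum n p 1
      + a₂ * residueSum n p 2 + a₃ * residueSum n p 3 + a₄ * residueSum n p 4
      + a₅ * residueSum n p 5 + a₆ * residueSum n p 6 + a₇ * residueSum n p 7 := by
  rw [S_eq_sum hn, Fin.sum_univ_eight]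
  rfl

lemma re_im_of_eq_S {z : ℂ} {c x y : ℝ} (h : z = c * x + c * y * I) :
    z.re = c * x ∧ z.im = c * y := by
  subst h
  simp

lemma re_im_of_eq_S_of_even {z : ℂ} {c x y : ℝ} (h : z = 2 ^ 3 * c * x + 2 ^ 3 * c * y * I) :
    z.re = 8 * c * x ∧ z.im = 8 * c * y := by
  have := re_im_of_eq_S (z := z) (c := 8 * c) (x := x) (y := y) (by rw [h]; push_cast; ring)
  exact this

lemma log_two_cubed_eq_S : Real.log 2 ^ 3 = 192 * S 3 1 ![0, 1, 0, 4, 0, 1, 0, 16]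
    - 32 * S 3 3 ![4, -3, -4, -1, -4, -3, 4, 7] := by
  have hn : 2 ≤ 3 := by norm_num
  have w := (re_im_of_eq_S Li_three_one_add_I_div_two_eq_S).1
  have u := (re_im_of_eq_S Li_three_one_add_I_div_four_eq_S).1
  have j := (re_im_of_eq_S_of_even Li_three_I_div_two_eq_S).1
  have a := (re_im_of_eq_S_of_even Li_three_half_eq_S).1
  have c := (re_im_of_eq_S_of_even Li_three_neg_half_eq_S).1
  have c' := (re_im_of_eq_S_of_even Li_three_neg_eighth_eq_S).1
  simp only [S_eq_residueSum hn] at w u j a c c' ⊢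
  push_cast at w u j a c c' ⊢
  -- With weights 132 on `Li_three_half_re`, `-6` on `Li_three_neg_eighth_re` and `-64` on the
  -- relation at `(1 + I) / 4`, both `lam 3` and `π² log 2` cancel.
  linarith [Li_three_half_re, Li_three_one_add_I_div_two_re, Li_three_neg_eighth_re,
    Li_three_one_add_I_div_four_re_im.1]

lemma lam_three_eq_S : lam 3 = 6 * S 3 1 ![1, -7, -1, 10, -1, -7, 1, 0]
    + 4 * S 3 3 ![1, 1, -1, -2, -1, 1, 1, 0] := by
  have hn : 2 ≤ 3 := by norm_num
  have w := (re_im_of_eq_S Li_three_one_add_I_div_two_eq_S).1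
  have u := (re_im_of_eq_S Li_three_one_add_I_div_four_eq_S).1
  have j := (re_im_of_eq_S_of_even Li_three_I_div_two_eq_S).1
  have a := (re_im_of_eq_S_of_even Li_three_half_eq_S).1
  have c := (re_im_of_eq_S_of_even Li_three_neg_half_eq_S).1
  have c' := (re_im_of_eq_S_of_even Li_three_neg_eighth_eq_S).1
  simp only [S_eq_residueSum hn] at w u j a c c' ⊢
  push_cast at w u j a c c' ⊢
  -- In the order listed, the weights `-3/4`, `6`, `-1/4`, `2` cancel `log³ 2` and `π² log 2`.
  linarith [Li_three_half_re, Li_three_one_add_I_div_two_re, Li_three_neg_eighth_re,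
    Li_three_one_add_I_div_four_re_im.1]

lemma pi_cubed_eq_S : Real.pi ^ 3 / 32 = 5 * S 3 1 ![1, -6, 1, 0, -1, 6, -1, 0]
    + 5 / 3 * S 3 3 ![1, 1, 1, 0, -1, -1, -1, 0] + 2 * S 3 5 ![1, 1, 1, 0, -1, -1, -1, 0] := by
  have hn : 2 ≤ 3 := by norm_num
  have w := (re_im_of_eq_S Li_three_one_add_I_div_two_eq_S).2
  have u := (re_im_of_eq_S Li_three_one_add_I_div_four_eq_S).2
  have v := (re_im_of_eq_S Li_three_one_add_I_div_eight_eq_S).2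
  have j := (re_im_of_eq_S_of_even Li_three_I_div_two_eq_S).2
  simp only [S_eq_residueSum hn] at w u v j ⊢
  push_cast at w u v j ⊢
  -- The weights `-7/6` and `1/2` cancel `π log² 2`.
  linarith [Li_three_one_add_I_div_four_re_im.2, Li_three_one_add_I_div_eight_re_im.2]

end

end Ladder

theorem mainTheorem3 :
    -- the real ladders
    (Ladder.lam 3 = Ladder.Abar 3 ∧
      Ladder.lam 3 = 2 / 5 * Ladder.Bbar 3 ∧
      Ladder.lam 3 = 9 / 7 * Ladder.Cbar 3 ∧
      Ladder.lam 3 = 3 * Ladder.Dbar 3 ∧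
      Ladder.lam 3 = 25 / 6 * Ladder.Ebar 3) ∧
    -- the imaginary ladders
    (Ladder.beta 3 = Real.pi ^ 3 / 32 ∧
      Ladder.beta 3 = 2 / 3 * Ladder.Fbar 3 - Ladder.Gbar 3 ∧
      Ladder.beta 3 = 20 / 23 * Ladder.Fbar 3 - 25 / 23 * Ladder.Hbar 3) ∧
    -- the series for `log³ 2`
    (Real.log 2 ^ 3 =
      192 * Ladder.S 3 1 ![0, 1, 0, 4, 0, 1, 0, 16]
        - 32 * Ladder.S 3 3 ![4, -3, -4, -1, -4, -3, 4, 7]) ∧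
    -- the series for `λ(3) = (7/8) ζ(3)`
    ((Ladder.lam 3 : ℂ) = 7 / 8 * riemannZeta 3 ∧
      Ladder.lam 3 =
        6 * Ladder.S 3 1 ![1, -7, -1, 10, -1, -7, 1, 0]
          + 4 * Ladder.S 3 3 ![1, 1, -1, -2, -1, 1, 1, 0]) ∧
    -- the series for `β(3) = π³/32`
    (Real.pi ^ 3 / 32 =
      5 * Ladder.S 3 1 ![1, -6, 1, 0, -1, 6, -1, 0]
        + 5 / 3 * Ladder.S 3 3 ![1, 1, 1, 0, -1, -1, -1, 0]
        + 2 * Ladder.S 3 5 ![1, 1, 1, 0, -1, -1, -1, 0]) := by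
  exact ⟨Ladder.real_ladders, ⟨Ladder.beta_three, Ladder.imaginary_ladders⟩,
    Ladder.log_two_cubed_eq_S, ⟨Ladder.lam_three_eq, Ladder.lam_three_eq_S⟩,
    Ladder.pi_cubed_eq_S⟩
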